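/- Let $\sigma\in\{1,-1\}$, $\varepsilon_1,\varepsilon_2,\omega\in\mathbb R$, $\alpha=i\varepsilon_1$, $\beta=i\varepsilon_2$, and let $U\subset\mathbb R^2$ be open and invariant under $(x,t)\mapsto(-x,t)$ (for instance $U=\mathbb R^2$). For a function $f(x,t)$ write $\hat f(x,t)=f^*(-x,t)$, where $*$ is complex conjugation. The PT-symmetric nonlocal Hirota--Maxwell--Bloch system for smooth complex-valued functions $E,p,\eta$ on $U$ is $$E_x=\beta\big(E_{ttt}-6\sigma E\hat E E_t\big)+\tfrac i2\alpha\big(E_{tt}-2\sigma E^2\hat E\big)+2\sigma p,\qquad p_t=2\sigma E\eta+2i\omega p,\qquad \eta_t=p\hat E-\hat pE,$$ together with the constraint $\eta=-\hat\eta$ (for real-valued $\eta$: $\eta(x,t)=-\eta(-x,t)$). Its Lax pair is $\varphi_t=M\varphi$, $\varphi_x=N\varphi$ with spectral parameter $\lambda\in\mathbb C$ ($\lambda\ne-\omega$ in $N$), where, with $q=E$, $r=\sigma\hat E$, $$M=\begin{pmatrix}-i\lambda&q\\ r&i\lambda\end{pmatrix},$$ $$N=\lambda^3\begin{pmatrix}4i\beta&0\\0&-4i\beta\end{pmatrix}+\lambda^2\begin{pmatrix}-i\alpha&-4\beta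 q\\-4\beta r&i\alpha\end{pmatrix}+\lambda\begin{pmatrix}2i\beta qr&-2i\beta q_t+\alpha q\\2i\beta r_t+\alpha r&-2i\beta qr\end{pmatrix}$$ $$\quad+\begin{pmatrix}\beta(qr_t-rq_t)-\frac i2\alpha qr&\beta(q_{tt}-2q^2r)+\frac i2\alpha q_t\\ \beta(r_{tt}-2qr^2)-\frac i2\alpha r_t&-\beta(qr_t-rq_t)+\frac i2\alpha qr\end{pmatrix}+\frac{i}{\lambda+\omega}\begin{pmatrix}\eta&-\sigma p\\-\hat p&-\eta\end{pmatrix}.$$ Let $(E,p,\eta)$ be a smooth solution on $U$, let $n\ge1$, and let $\lambda_1,\dots,\lambda_{2n}\in\mathbb C\setminus\{-\omega\}$ with $\lambda_{2j}=\lambda_{2j-1}^*$. For $1\le k\le 2n$ let $(\varphi_{1,k},\varphi_{2,k})^{\mathrm T}$ be a smooth solution on $U$ of the Lax pair with $\lambda=\lambda_k$, and suppose that for $1\le j\le n$, with a sign $\zeta_j\in\{1,-1\}$, $$\varphi_{1,2j}(x,t)=\zeta_j\varphi_{2,2j-1}^*(-x,t),\qquad \varphi_{2,2j}(x,t)=\sigma\zeta_j\varphi_{1,2j-1}^*(-x,t).$$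 Let $H$ be the $2n\times2n$ matrix with $k$-th column $(\varphi_{1,k},\varphi_{2,k},\lambda_k\varphi_{1,k},\lambda_k\varphi_{2,k},\dots,\lambda_k^{n-1}\varphi_{1,k},\lambda_k^{n-1}\varphi_{2,k})^{\mathrm T}$, and let $V=\{(x,t)\in U:\det H(x,t)\neq0\}$. On $V$ put, for $\lambda\in\mathbb C$ and $i,j\in\{1,2\}$, $$(T_n(\lambda))_{ij}=\frac{1}{\det H^{\mathrm T}}\det\begin{pmatrix}A_j&B_{ij}\\ H^{\mathrm T}&D_i\end{pmatrix},$$ where $A_1=(1,0,\lambda,0,\dots,\lambda^{n-1},0)$, $A_2=(0,1,0,\lambda,\dots,0,\lambda^{n-1})$, $B_{ij}=\lambda^n$ if $i=j$ and $0$ otherwise, $D_i=(\lambda_1^n\varphi_{i,1},\dots,\lambda_{2n}^n\varphi_{i,2n})^{\mathrm T}$. Then: 1. (The $n$-fold Darboux transformation has this determinant form.) Put $T^{(0)}(\lambda)=I$ and, for $0\le m<n$, $T^{(m+1)}(\lambda)=(\lambda I-G_m\Lambda_mG_m^{-1})\,T^{(m)}(\lambda)$, where $\Lambda_m=\mathrm{diag}(\lambda_{2m+1},\lambda_{2m+2})$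 and $G_m$ has the columns $T^{(m)}(\lambda_k)(\varphi_{1,k},\varphi_{2,k})^{\mathrm T}$, $k=2m+1,2m+2$. At every point of $U$ where $\det G_m\ne0$ for all $0\le m<n$, one has $\det H\neq0$ and $T^{(n)}(\lambda)=T_n(\lambda)$ for all $\lambda$. 2. There are $2\times2$ matrix functions $S_0,\dots,S_{n-1}$ of $(x,t)$ such that $T_n(\lambda)=\lambda^nI-S_{n-1}\lambda^{n-1}-\cdots-S_1\lambda-S_0$ on $V$ for all $\lambda\in\mathbb C$. 3. Writing $T_{ij}=(T_n(-\omega))_{ij}$, the function $\Delta=T_{11}T_{22}-T_{12}T_{21}$ has no zero on $V$, the set $V$ is open and invariant under $(x,t)\mapsto(-x,t)$, and $$E^{[n]}=E-2i(S_{n-1})_{12},\qquad p^{[n]}=\frac{p\,T_{11}^2-\sigma\hat p\,T_{12}^2+2\sigma\eta\,T_{11}T_{12}}{\Delta},$$ $$\eta^{[n]}=\frac{\sigma p\,T_{11}T_{21}-\hat p\,T_{12}T_{22}+\eta\,(T_{11}T_{22}+T_{12}T_{21})}{\Delta}$$ are smooth on $V$ and solve there the same system, including the constraint $\eta^{[n]}=-\widehat{\eta^{[n]}}$.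 4. $T_n$ is a Darboux matrix: if $M^{[n]},N^{[n]}$ are the matrices $M,N$ formed with $(E^{[n]},p^{[n]},\eta^{[n]})$, then on $V$ $$(T_n)_t=M^{[n]}T_n-T_nM\quad\text{for all }\lambda,\qquad (T_n)_x=N^{[n]}T_n-T_nN\quad\text{for all }\lambda\neq-\omega.$$ -/

import Mathlib

open scoped ComplexConjugate Matrix

noncomputable section

namespace NHMB

/-- Partial derivative in the space variable `x` of a function of `(x, t)`. -/
def dx (f : ℝ → ℝ → ℂ) : ℝ → ℝ → ℂ := fun x t => deriv (fun y => f y t) x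

/-- Partial derivative in the time variable `t` of a function of `(x, t)`. -/
def dt (f : ℝ → ℝ → ℂ) : ℝ → ℝ → ℂ := fun x t => deriv (fun s => f x s) t

/-- The PT reflection `f*(-x, t)`. -/
def pt (f : ℝ → ℝ → ℂ) : ℝ → ℝ → ℂ := fun x t => conj (f (-x) t)

/-- Smoothness, jointly in `(x, t)`, on a set of the plane. -/
def SmoothOn (U : Set (ℝ × ℝ)) (f : ℝ → ℝ → ℂ) : Prop :=
  ContDiffOn ℝ (⊤ : ℕ∞) (fun z : ℝ × ℝ => f z.1 z.2) U

/-- Open subsets of the plane that are invariant under `(x, t) ↦ (-x, t)`. -/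
structure IsPTDomain (U : Set (ℝ × ℝ)) : Prop where
  isOpen : IsOpen U
  symm : ∀ x t : ℝ, (x, t) ∈ U → (-x, t) ∈ U

/-- `(E, p, η)` is a smooth solution on `U` of the PT-symmetric nonlocal Hirota and
Maxwell-Bloch system with `α = i ε₁`, `β = i ε₂`. -/
structure IsSolutionOn (σ : ℂ) (ε₁ ε₂ ω : ℝ) (U : Set (ℝ × ℝ)) (E p η : ℝ → ℝ → ℂ) :
    Prop where
  domain : IsPTDomain U
  smooth_E : SmoothOn U E
  smooth_p : SmoothOn U p
  smooth_η : SmoothOn U η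
  eq_E : ∀ x t : ℝ, (x, t) ∈ U →
    dx E x t =
      (Complex.I * ε₂) * (dt (dt (dt E)) x t - 6 * σ * E x t * pt E x t * dt E x t)
      + Complex.I / 2 * (Complex.I * ε₁) * (dt (dt E) x t - 2 * σ * (E x t) ^ 2 * pt E x t)
      + 2 * σ * p x t
  eq_p : ∀ x t : ℝ, (x, t) ∈ U →
    dt p x t = 2 * σ * E x t * η x t + 2 * Complex.I * ω * p x t
  eq_η : ∀ x t : ℝ, (x, t) ∈ U →
    dt η x t = p x t * pt E x t - pt p x t * E x t
  symm_η : ∀ x t : ℝ, (x, t) ∈ U → η x t = -pt η x t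

/-- The AKNS matrix `M` with potentials `q`, `r` and spectral parameter `μ`. -/
def laxM (q r : ℝ → ℝ → ℂ) (μ : ℂ) (x t : ℝ) : Matrix (Fin 2) (Fin 2) ℂ :=
  !![-Complex.I * μ, q x t; r x t, Complex.I * μ]

/-- The matrix `N` (coefficients of `μ ^ 3`, `μ ^ 2`, `μ`, `1` and the pole at `-ω`). -/
def laxN (α β ω δ : ℂ) (q r p m η : ℝ → ℝ → ℂ) (μ : ℂ) (x t : ℝ) :
    Matrix (Fin 2) (Fin 2) ℂ :=
  μ ^ 3 • !![4 * Complex.I * β, 0; 0, -4 * Complex.I * β]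
  + μ ^ 2 • !![-Complex.I * α, -4 * β * q x t; -4 * β * r x t, Complex.I * α]
  + μ • !![2 * Complex.I * β * q x t * r x t, -2 * Complex.I * β * dt q x t + α * q x t;
      2 * Complex.I * β * dt r x t + α * r x t, -2 * Complex.I * β * q x t * r x t]
  + !![β * (q x t * dt r x t - r x t * dt q x t) - Complex.I / 2 * α * q x t * r x t,
      β * (dt (dt q) x t - 2 * (q x t) ^ 2 * r x t) + Complex.I / 2 * α * dt q x t;
      β * (dt (dt r) x t - 2 * q x t * (r x t) ^ 2) - Complex.I / 2 * α * dt r x t,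
      -β * (q x t * dt r x t - r x t * dt q x t) + Complex.I / 2 * α * q x t * r x t]
  + (Complex.I / (μ + ω)) • !![η x t, -δ * p x t; -δ * m x t, -η x t]

/-- `M` under the PT reduction `q = E`, `r = σ E*(-x, t)`. -/
def ptM (σ : ℂ) (E : ℝ → ℝ → ℂ) (μ : ℂ) (x t : ℝ) : Matrix (Fin 2) (Fin 2) ℂ :=
  laxM E (fun x t => σ * pt E x t) μ x t

/-- `N` under the PT reduction `q = E`, `r = σ E*(-x, t)`, `m = σ p*(-x, t)`, `δ = σ`,
`α = i ε₁`, `β = i ε₂`. -/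
def ptN (σ : ℂ) (ε₁ ε₂ ω : ℝ) (E p η : ℝ → ℝ → ℂ) (μ : ℂ) (x t : ℝ) :
    Matrix (Fin 2) (Fin 2) ℂ :=
  laxN (Complex.I * ε₁) (Complex.I * ε₂) ω σ E (fun x t => σ * pt E x t)
    p (fun x t => σ * pt p x t) η μ x t

/-- `φ` is a smooth solution on `U` of the linear problem `φ_t = M φ`, `φ_x = N φ` with
spectral parameter `μ`. -/
structure IsEigenfunctionOn (σ : ℂ) (ε₁ ε₂ ω : ℝ) (U : Set (ℝ × ℝ)) (E p η : ℝ → ℝ → ℂ)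
    (μ : ℂ) (φ : ℝ → ℝ → Fin 2 → ℂ) : Prop where
  smooth : ContDiffOn ℝ (⊤ : ℕ∞) (fun z : ℝ × ℝ => φ z.1 z.2) U
  eq_t : ∀ x t : ℝ, (x, t) ∈ U →
    HasDerivAt (fun s => φ x s) (ptM σ E μ x t *ᵥ φ x t) t
  eq_x : ∀ x t : ℝ, (x, t) ∈ U →
    HasDerivAt (fun y => φ y t) (ptN σ ε₁ ε₂ ω E p η μ x t *ᵥ φ x t) x

/-- The component (`0` or `1`) to which the `a`-th entry of the list
`λ^0 φ_1, λ^0 φ_2, λ^1 φ_1, λ^1 φ_2, …` belongs; the power of `λ` in it is `a / 2`. -/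
def comp (a : ℕ) : Fin 2 := Fin.ofNat 2 a

/-- The `2n × 2n` matrix `H` built from the first `2n` spectral parameters and eigenfunctions. -/
def Hmat (n : ℕ) (lam : ℕ → ℂ) (φ : ℕ → ℝ → ℝ → Fin 2 → ℂ) (x t : ℝ) :
    Matrix (Fin (2 * n)) (Fin (2 * n)) ℂ :=
  fun a k => lam k ^ ((a : ℕ) / 2) * φ k x t (comp a)

/-- The row `A_{ij}`, which depends on `j` only. -/
def rowA (n : ℕ) (μ : ℂ) (j : Fin 2) : Fin (2 * n) → ℂ :=
  fun a => if comp a = j then μ ^ ((a : ℕ) / 2) else 0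

/-- The `1 × 1` block `B_{ij}`. -/
def entryB (n : ℕ) (μ : ℂ) (i j : Fin 2) : ℂ := if i = j then μ ^ n else 0

/-- The column `D_{ij}`, which depends on `i` only. -/
def colD (n : ℕ) (lam : ℕ → ℂ) (φ : ℕ → ℝ → ℝ → Fin 2 → ℂ) (x t : ℝ) (i : Fin 2) :
    Fin (2 * n) → ℂ :=
  fun k => lam k ^ n * φ k x t i

/-- The bordered matrix with first row `(A_{ij}, B_{ij})` above `(Hᵀ, D_{ij})`. -/
def bordered (n : ℕ) (lam : ℕ → ℂ) (φ : ℕ → ℝ → ℝ → Fin 2 → ℂ) (μ : ℂ) (x t : ℝ)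
    (i j : Fin 2) : Matrix (Fin (2 * n + 1)) (Fin (2 * n + 1)) ℂ :=
  Fin.cons (Fin.snoc (α := fun _ => ℂ) (rowA n μ j) (entryB n μ i j))
    (fun k => Fin.snoc (α := fun _ => ℂ) ((Hmat n lam φ x t)ᵀ k) (colD n lam φ x t i k))

/-- The matrix `T_n` given by the ratios of determinants. -/
def darbouxMatrix (n : ℕ) (lam : ℕ → ℂ) (φ : ℕ → ℝ → ℝ → Fin 2 → ℂ) (μ : ℂ) (x t : ℝ) :
    Matrix (Fin 2) (Fin 2) ℂ :=
  fun i j => (bordered n lam φ μ x t i j).det / ((Hmat n lam φ x t)ᵀ).det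

/-- The `2 × 2` matrix whose columns are the `(2m+1)`-st and `(2m+2)`-nd eigenfunctions, after
the transformation by a matrix `T` depending on the spectral parameter. -/
def pairMat (T : ℂ → Matrix (Fin 2) (Fin 2) ℂ) (m : ℕ) (lam : ℕ → ℂ)
    (φ : ℕ → ℝ → ℝ → Fin 2 → ℂ) (x t : ℝ) : Matrix (Fin 2) (Fin 2) ℂ :=
  Matrix.of fun i c =>
    (T (lam (2 * m + (c : ℕ))) *ᵥ φ (2 * m + (c : ℕ)) x t) i

/-- The composition of `m` successive one-fold Darboux matrices `μ I - G Λ G⁻¹`, the columns of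
`G` being the next pair of eigenfunctions transformed by the previous steps. -/
def iteratedDarboux (lam : ℕ → ℂ) (φ : ℕ → ℝ → ℝ → Fin 2 → ℂ) (x t : ℝ) :
    ℕ → ℂ → Matrix (Fin 2) (Fin 2) ℂ
  | 0 => fun _ => 1
  | m + 1 => fun μ =>
      (μ • (1 : Matrix (Fin 2) (Fin 2) ℂ)
        - pairMat (iteratedDarboux lam φ x t m) m lam φ x t
          * Matrix.diagonal ![lam (2 * m), lam (2 * m + 1)]
          * (pairMat (iteratedDarboux lam φ x t m) m lam φ x t)⁻¹)
      * iteratedDarboux lam φ x t m μ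

/-- `E^{[n]}` in terms of the coefficient `S = S_{n-1}` of the Darboux matrix. -/
def newE (S : ℝ → ℝ → Matrix (Fin 2) (Fin 2) ℂ) (E : ℝ → ℝ → ℂ) : ℝ → ℝ → ℂ :=
  fun x t => E x t - 2 * Complex.I * S x t 0 1

/-- `p^{[n]}` in terms of the Darboux matrix `T` taken at `λ = -ω`. -/
def newP (σ : ℂ) (T : ℝ → ℝ → Matrix (Fin 2) (Fin 2) ℂ) (p η : ℝ → ℝ → ℂ) : ℝ → ℝ → ℂ :=
  fun x t =>
    (p x t * (T x t 0 0) ^ 2 - σ * pt p x t * (T x t 0 1) ^ 2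
        + 2 * σ * η x t * T x t 0 0 * T x t 0 1)
      / (T x t 0 0 * T x t 1 1 - T x t 0 1 * T x t 1 0)

/-- `η^{[n]}` in terms of the Darboux matrix `T` taken at `λ = -ω`. -/
def newη (σ : ℂ) (T : ℝ → ℝ → Matrix (Fin 2) (Fin 2) ℂ) (p η : ℝ → ℝ → ℂ) : ℝ → ℝ → ℂ :=
  fun x t =>
    (σ * p x t * T x t 0 0 * T x t 1 0 - pt p x t * T x t 0 1 * T x t 1 1
        + η x t * (T x t 0 0 * T x t 1 1 + T x t 0 1 * T x t 1 0))
      / (T x t 0 0 * T x t 1 1 - T x t 0 1 * T x t 1 0)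

/-- The points of `U` at which the denominator of the Darboux matrix does not vanish. -/
def regularSet (n : ℕ) (U : Set (ℝ × ℝ)) (lam : ℕ → ℂ) (φ : ℕ → ℝ → ℝ → Fin 2 → ℂ) :
    Set (ℝ × ℝ) :=
  {z | z ∈ U ∧ ((Hmat n lam φ z.1 z.2)ᵀ).det ≠ 0}

end NHMB

end

/-!
The coefficients of `T_n(μ) = μ ^ n - ∑ S_k μ ^ k` are, by Cramer's rule, the solution of the linear
system `T_n(λ_k) φ_k = 0`, `k < 2n` (`darbouxMatrix_eq_monicSum`, `monicSum_darbouxCoeff_mulVec`).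
Everything rests on the uniqueness behind this system: `det H ≠ 0` says exactly that a matrix
polynomial of degree less than `n` whose value at each `λ_k` kills `φ_k` is zero (`Unisolvent`,
`unisolvent_iff_det_ne_zero`). No distinctness of the `λ_k` is needed. Its consequences are:

* the iterated one-fold transformation is monic of degree `n` and kills the same vectors, and
  division with remainder by its partial products shows that `det H ≠ 0`, so it equals `T_n`
  (`iteratedDarboux_eq_darbouxMatrix`);
* `T_n(-ω)` is invertible: a row `w` with `w T_n(-ω) = 0` would give the polynomial
  `w T_n(μ) / (μ + ω)` of degree less than `n` killing all `φ_k`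
  (`Unisolvent.det_monicSum_ne_zero`);
* the pairing of the eigenfunctions makes `V` symmetric and `T_n` PT symmetric
  (`IsPartner.unisolvent`, `IsPartner.eq_conjMat`);
* if `L` is one of the old Lax matrices, `L'` the new one and `∂` the corresponding derivative, then
  `∂T + T L - L' T` kills `φ_k` at `λ_k`, so it vanishes as soon as its degree is less than `n`
  (`Unisolvent.evolution`).

For `M` the degree condition defines `E^{[n]}`, the PT symmetry taking care of `r = σ E*(-x, t)`. The
resulting equation `T_t = M' T - T M` is differentiated repeatedly in `t` along with the definition of
`E^{[n]}`; this expresses the off-diagonal parts of the top coefficients `S_{n-1}, S_{n-2}, …`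
through the potentials (`JetRel`), after which the degree condition for `N` is a polynomial identity
(`JetRel.topMatch`). The pole of `N` is harmless because the new residue matrix is the conjugate of
the old one by `T(-ω)` (`DarbouxData.poleMat_mul`), which is what the formulas for `p^{[n]}` and
`η^{[n]}` say.

The system for the new functions needs no zero curvature equation. The top coefficient of
`T_x = N' T - T N` contains the equation for `E^{[n]}`, again by a polynomial identity in jets
(`JetRel.evolution_identity`). The equations for `p` and `η` say that the residue matrix `P`
satisfies `P_t = [M(-ω), P]`, and this is preserved under conjugation by `T(-ω)`
(`DarbouxData.hasMatDeriv_newPoleMat`).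
-/

noncomputable section

namespace NHMB

/-! ### Matrix polynomials and the Darboux mechanism -/

/-- The `2 × 2` complex matrices, in which the Lax pair lives. -/
abbrev Mat2 : Type := Matrix (Fin 2) (Fin 2) ℂ

/-- The polynomial `∑_{k < n} μ ^ k C_k` with matrix coefficients, as a function of `μ`. -/
def coeffSum (n : ℕ) (C : ℕ → Mat2) (μ : ℂ) : Mat2 :=
  ∑ k ∈ Finset.range n, μ ^ k • C k

/-- The monic polynomial `μ ^ n - ∑_{k < n} μ ^ k C_k` with matrix coefficients. -/
def monicSum (n : ℕ) (C : ℕ → Mat2) (μ : ℂ) : Mat2 :=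
  μ ^ n • (1 : Mat2) - coeffSum n C μ

/-- The coefficient sequence shifted by one place, that is, multiplied by the variable. -/
def shift (C : ℕ → Mat2) : ℕ → Mat2
  | 0 => 0
  | k + 1 => C k

lemma smul_coeffSum {n : ℕ} (hn : 0 < n) (C : ℕ → Mat2) (μ : ℂ) :
    μ • coeffSum n C μ = μ ^ n • C (n - 1) + coeffSum n (shift C) μ := by
  obtain ⟨m, rfl⟩ : ∃ m, n = m + 1 := ⟨n - 1, by omega⟩
  simp only [coeffSum]
  rw [Finset.sum_range_succ, Finset.sum_range_succ', smul_add, Finset.smul_sum]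
  simp only [shift, smul_smul, smul_zero, add_zero, Nat.add_sub_cancel]
  rw [add_comm]
  congr 1
  · rw [pow_succ']
  · exact Finset.sum_congr rfl fun k _ => by rw [pow_succ']

lemma coeffSum_add (n : ℕ) (C D : ℕ → Mat2) (μ : ℂ) :
    coeffSum n (fun k => C k + D k) μ = coeffSum n C μ + coeffSum n D μ := by
  simp [coeffSum, Finset.sum_add_distrib]

lemma coeffSum_sub (n : ℕ) (C D : ℕ → Mat2) (μ : ℂ) :
    coeffSum n (fun k => C k - D k) μ = coeffSum n C μ - coeffSum n D μ := by
  simp [coeffSum, smul_sub, Finset.sum_sub_distrib]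

lemma coeffSum_mul_left (n : ℕ) (A : Mat2) (C : ℕ → Mat2) (μ : ℂ) :
    coeffSum n (fun k => A * C k) μ = A * coeffSum n C μ := by
  simp [coeffSum, Finset.mul_sum]

lemma coeffSum_mul_right (n : ℕ) (C : ℕ → Mat2) (A : Mat2) (μ : ℂ) :
    coeffSum n (fun k => C k * A) μ = coeffSum n C μ * A := by
  simp [coeffSum, Finset.sum_mul]

lemma coeffSum_smul (n : ℕ) (c : ℂ) (C : ℕ → Mat2) (μ : ℂ) :
    coeffSum n (fun k => c • C k) μ = c • coeffSum n C μ := by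
  simp [coeffSum, Finset.smul_sum, smul_comm c]

lemma coeffSum_congr {n : ℕ} {C D : ℕ → Mat2} (h : ∀ k < n, C k = D k) (μ : ℂ) :
    coeffSum n C μ = coeffSum n D μ :=
  Finset.sum_congr rfl fun k hk => by rw [h k (Finset.mem_range.1 hk)]

lemma coeffSum_apply (n : ℕ) (C : ℕ → Mat2) (μ : ℂ) (i j : Fin 2) :
    coeffSum n C μ i j = ∑ k ∈ Finset.range n, μ ^ k * C k i j := by
  simp [coeffSum, Matrix.sum_apply]

/-- Division by a linear factor: a polynomial `μ ^ n A + ∑_{k < n} μ ^ k B_k` vanishing at `c` is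
`(μ - c)` times a polynomial with leading term `μ ^ (n - 1) A`. -/
lemma exists_coeffSum_quotient (n : ℕ) (A : Mat2) (B : ℕ → Mat2) (c : ℂ)
    (h : c ^ n • A + coeffSum n B c = 0) :
    ∃ Z : ℕ → Mat2, (∀ μ : ℂ, μ ^ n • A + coeffSum n B μ = (μ - c) • coeffSum n Z μ) ∧
      (0 < n → Z (n - 1) = A) := by
  induction n generalizing A with
  | zero => exact ⟨fun _ => 0, fun μ => by simpa [coeffSum] using h, fun h => by omega⟩
  | succ n ih =>
    have key : ∀ μ : ℂ, μ ^ (n + 1) • A + coeffSum (n + 1) B μ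
        = (μ - c) • μ ^ n • A + (μ ^ n • (c • A + B n) + coeffSum n B μ) := by
      intro μ
      simp only [coeffSum, Finset.sum_range_succ]
      module
    obtain ⟨Z, hZ, -⟩ := ih (c • A + B n) (by simpa [key] using h)
    refine ⟨Function.update Z n A, fun μ => ?_, fun _ => by simp⟩
    have hc : coeffSum n (Function.update Z n A) μ = coeffSum n Z μ :=
      coeffSum_congr (fun k hk => by simp [Function.update_of_ne hk.ne]) μ
    have hs : coeffSum (n + 1) (Function.update Z n A) μ = coeffSum n Z μ + μ ^ n • A := by
      rw [← hc]; simp [coeffSum, Finset.sum_range_succ]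
    rw [key, hZ, hs]
    module

/-- The only polynomial of degree less than `n` in `μ`, with matrix coefficients, whose value at
each of the `2n` parameters `lam k` kills the vector `v k`, is zero. -/
def Unisolvent (n : ℕ) (lam : ℕ → ℂ) (v : ℕ → Fin 2 → ℂ) : Prop :=
  ∀ C : ℕ → Mat2, (∀ k < 2 * n, coeffSum n C (lam k) *ᵥ v k = 0) → ∀ m < n, C m = 0

lemma Unisolvent.eq_of_monicSum_mulVec {n : ℕ} {lam : ℕ → ℂ} {v : ℕ → Fin 2 → ℂ}
    (hu : Unisolvent n lam v) {C D : ℕ → Mat2}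
    (hC : ∀ k < 2 * n, monicSum n C (lam k) *ᵥ v k = 0)
    (hD : ∀ k < 2 * n, monicSum n D (lam k) *ᵥ v k = 0) {m : ℕ} (hm : m < n) : C m = D m := by
  refine sub_eq_zero.1 (hu (fun k => C k - D k) (fun k hk => ?_) m hm)
  have e : coeffSum n C (lam k) - coeffSum n D (lam k)
      = monicSum n D (lam k) - monicSum n C (lam k) := by simp [monicSum]
  rw [coeffSum_sub, e, Matrix.sub_mulVec, hC k hk, hD k hk, sub_zero]

/-- If `w T(c) = 0` for a row `w ≠ 0`, then `w T` is divisible by `μ - c`, and the quotient, of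
degree less than `n`, still kills all `v k`. -/
lemma Unisolvent.det_monicSum_ne_zero {n : ℕ} (hn : 0 < n) {lam : ℕ → ℂ} {v : ℕ → Fin 2 → ℂ}
    (hu : Unisolvent n lam v) {C : ℕ → Mat2}
    (hC : ∀ k < 2 * n, monicSum n C (lam k) *ᵥ v k = 0) {c : ℂ}
    (hc : ∀ k < 2 * n, lam k ≠ c) : (monicSum n C c).det ≠ 0 := by
  intro h0
  obtain ⟨w, hw, hwT⟩ := Matrix.exists_vecMul_eq_zero_iff.2 h0
  set A : Mat2 := Matrix.of fun _ => w with hA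
  have hAT : ∀ μ, A * monicSum n C μ = μ ^ n • A + coeffSum n (fun k => (-A) * C k) μ := by
    intro μ
    rw [coeffSum_mul_left, monicSum, mul_sub, mul_smul_comm, mul_one, neg_mul, sub_eq_add_neg]
  have hz : A * monicSum n C c = 0 := by
    ext i j
    simpa [hA, Matrix.mul_apply, Matrix.vecMul, dotProduct] using congrFun hwT j
  obtain ⟨Z, hZ, hZn⟩ := exists_coeffSum_quotient n A (fun k => (-A) * C k) c (by rw [← hAT, hz])
  have hZ0 := hu Z fun k hk => by
    have h1 : (lam k - c) • (coeffSum n Z (lam k) *ᵥ v k) = 0 := by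
      rw [← Matrix.smul_mulVec, ← hZ, ← hAT, ← Matrix.mulVec_mulVec, hC k hk, Matrix.mulVec_zero]
    exact (smul_eq_zero.1 h1).resolve_left (sub_ne_zero.2 (hc k hk))
  have hA0 : A = 0 := by rw [← hZn hn]; exact hZ0 _ (by omega)
  exact hw (funext fun j => by simpa [hA] using congrFun (congrFun hA0 0) j)

/-- A cubic polynomial in `μ` with matrix coefficients, plus a term with scalar factor `s` (the
value at `μ` of the pole term of the Lax matrix). -/
def cubic (N : Fin 4 → Mat2) (s : ℂ) (P : Mat2) (μ : ℂ) : Mat2 :=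
  μ ^ 3 • N 3 + μ ^ 2 • N 2 + μ • N 1 + N 0 + s • P

/-- Right hand side of the evolution equation of the coefficients `C_k` of a Darboux matrix. -/
def evolRHS (N N' : Fin 4 → Mat2) (C Z : ℕ → Mat2) (k : ℕ) : Mat2 :=
  (N' 0 * C k - C k * N 0) + (N' 1 * shift C k - shift C k * N 1)
    + (N' 2 * shift (shift C) k - shift (shift C) k * N 2)
    + (N' 3 * shift (shift (shift C)) k - shift (shift (shift C)) k * N 3) + Z k

/-- The conditions that `T N - N' T` have no terms of degree `n, …, n + 3` when
`T = μ ^ n - S₁ μ ^ (n - 1) - S₂ μ ^ (n - 2) - S₃ μ ^ (n - 3) - ⋯`. -/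
structure TopMatch (N N' : Fin 4 → Mat2) (S₁ S₂ S₃ : Mat2) : Prop where
  three : N 3 = N' 3
  two : N 2 - N' 2 - (S₁ * N 3 - N' 3 * S₁) = 0
  one : N 1 - N' 1 - (S₁ * N 2 - N' 2 * S₁) - (S₂ * N 3 - N' 3 * S₂) = 0
  zero : N 0 - N' 0 - (S₁ * N 1 - N' 1 * S₁) - (S₂ * N 2 - N' 2 * S₂)
    - (S₃ * N 3 - N' 3 * S₃) = 0

lemma coeffSum_evolRHS {n : ℕ} (hn : 0 < n) {N N' : Fin 4 → Mat2} {C Z : ℕ → Mat2} {P P' : Mat2}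
    (htop : TopMatch N N' (C (n - 1)) (shift C (n - 1)) (shift (shift C) (n - 1))) {s μ : ℂ}
    (hs : s • (monicSum n C μ * P - P' * monicSum n C μ) = coeffSum n Z μ) :
    coeffSum n (evolRHS N N' C Z) μ
      = monicSum n C μ * cubic N s P μ - cubic N' s P' μ * monicSum n C μ := by
  have e0 := smul_coeffSum hn C μ
  have e1 := smul_coeffSum hn (shift C) μ
  have e2 := smul_coeffSum hn (shift (shift C)) μ
  have hR : coeffSum n (evolRHS N N' C Z) μ =
      (N' 0 * coeffSum n C μ - coeffSum n C μ * N 0)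
      + (N' 1 * coeffSum n (shift C) μ - coeffSum n (shift C) μ * N 1)
      + (N' 2 * coeffSum n (shift (shift C)) μ - coeffSum n (shift (shift C)) μ * N 2)
      + (N' 3 * coeffSum n (shift (shift (shift C))) μ
          - coeffSum n (shift (shift (shift C))) μ * N 3) + coeffSum n Z μ := by
    unfold evolRHS
    simp only [coeffSum_add, coeffSum_sub, coeffSum_mul_left, coeffSum_mul_right]
  rw [hR, ← hs]
  obtain ⟨t3, t2, t1, t0⟩ := htop
  have f1 : coeffSum n (shift C) μ = μ • coeffSum n C μ - μ ^ n • C (n - 1) := by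
    rw [e0]; abel
  have f2 : coeffSum n (shift (shift C)) μ
      = μ • coeffSum n (shift C) μ - μ ^ n • shift C (n - 1) := by
    rw [e1]; abel
  have f3 : coeffSum n (shift (shift (shift C))) μ
      = μ • coeffSum n (shift (shift C)) μ - μ ^ n • shift (shift C) (n - 1) := by
    rw [e2]; abel
  rw [f3, f2, f1]
  simp only [monicSum, cubic]
  simp only [mul_sub, sub_mul, mul_add, add_mul, smul_mul_assoc, mul_smul_comm, smul_sub, smul_add,
    one_mul, mul_one] at t1 t2 t0 ⊢
  linear_combination (norm := module) (-(μ ^ n)) • t0 - (μ ^ (n + 1)) • t1 - (μ ^ (n + 2)) • t2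
    - (μ ^ (n + 3)) • t3

/-- The Darboux mechanism. Let `T(μ) = μ ^ n - ∑ C_k μ ^ k` kill `v k` at `μ = lam k`, let `-D_k`
be the derivatives of the coefficients of `T`, and let the derivative of `v k` be `L(lam k) v k`.
If `T L - L' T` has degree less than `n`, then `T' = L' T - T L`, since the difference is a
polynomial of degree less than `n` killing all `v k`. -/
lemma Unisolvent.evolution {n : ℕ} (hn : 0 < n) {lam : ℕ → ℂ} {v : ℕ → Fin 2 → ℂ}
    (hu : Unisolvent n lam v) {N N' : Fin 4 → Mat2} {C D Z : ℕ → Mat2} {P P' : Mat2}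
    (htop : TopMatch N N' (C (n - 1)) (shift C (n - 1)) (shift (shift C) (n - 1)))
    {s : ℂ → ℂ} {good : ℂ → Prop}
    (hs : ∀ μ, good μ → s μ • (monicSum n C μ * P - P' * monicSum n C μ) = coeffSum n Z μ)
    (hgood : ∀ k < 2 * n, good (lam k))
    (hkill : ∀ k < 2 * n, monicSum n C (lam k) *ᵥ v k = 0)
    (hder : ∀ k < 2 * n, -(coeffSum n D (lam k)) *ᵥ v k
      + monicSum n C (lam k) *ᵥ (cubic N (s (lam k)) P (lam k) *ᵥ v k) = 0) :
    (∀ m < n, D m = evolRHS N N' C Z m) ∧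
    ∀ μ, good μ → -(coeffSum n D μ)
      = cubic N' (s μ) P' μ * monicSum n C μ - monicSum n C μ * cubic N (s μ) P μ := by
  have h1 : ∀ m < n, D m = evolRHS N N' C Z m := by
    intro m hm
    refine sub_eq_zero.1 (hu (fun k => D k - evolRHS N N' C Z k) (fun k hk => ?_) m hm)
    rw [coeffSum_sub, coeffSum_evolRHS hn htop (hs _ (hgood k hk)), Matrix.sub_mulVec,
      Matrix.sub_mulVec, ← Matrix.mulVec_mulVec, ← Matrix.mulVec_mulVec, hkill k hk,
      Matrix.mulVec_zero, sub_zero]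
    have := hder k hk
    rw [Matrix.neg_mulVec] at this
    rw [← neg_eq_zero, ← this]; abel
  refine ⟨h1, fun μ hμ => ?_⟩
  rw [coeffSum_congr h1, coeffSum_evolRHS hn htop (hs _ hμ)]; abel

/-! ### The ratio of determinants and the iterated transformation -/

lemma comp_two_mul (k : ℕ) : comp (2 * k) = 0 := by
  simp [comp, Fin.ofNat]

lemma comp_two_mul_add_one (k : ℕ) : comp (2 * k + 1) = 1 := by
  ext; simp [comp, Fin.ofNat]

lemma sum_fin_two_mul {M : Type*} [AddCommMonoid M] (n : ℕ) (g : ℕ → Fin 2 → M) :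
    ∑ a : Fin (2 * n), g ((a : ℕ) / 2) (comp a) = ∑ k ∈ Finset.range n, (g k 0 + g k 1) := by
  rw [Fin.sum_univ_eq_sum_range (fun a => g (a / 2) (comp a))]
  induction n with
  | zero => simp
  | succ n ih =>
    rw [Finset.sum_range_succ, ← ih, show 2 * (n + 1) = 2 * n + 1 + 1 by ring,
      Finset.sum_range_succ, Finset.sum_range_succ, comp_two_mul, comp_two_mul_add_one,
      show 2 * n / 2 = n by omega, show (2 * n + 1) / 2 = n by omega, add_assoc]

/-- Row vectors of length `2n` as coefficient sequences: entry `2k + j` is the `j`-th entry of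
the `k`-th coefficient. The coefficients with `k ≥ n` are set to zero. -/
def unpack (n : ℕ) (w : Fin (2 * n) → ℂ) (k : ℕ) (j : Fin 2) : ℂ :=
  if h : 2 * k + j < 2 * n then w ⟨2 * k + j, h⟩ else 0

lemma unpack_apply {n : ℕ} (w : Fin (2 * n) → ℂ) (a : Fin (2 * n)) :
    unpack n w ((a : ℕ) / 2) (comp a) = w a := by
  have h : 2 * ((a : ℕ) / 2) + (comp a : ℕ) = a := by
    simp only [comp, Fin.ofNat]; omega
  simp only [unpack, h, a.2, dif_pos, Fin.eta]

lemma Hmat_transpose_mulVec (n : ℕ) (lam : ℕ → ℂ) (φ : ℕ → ℝ → ℝ → Fin 2 → ℂ) (x t : ℝ)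
    (w : ℕ → Fin 2 → ℂ) (k : Fin (2 * n)) :
    ((Hmat n lam φ x t)ᵀ *ᵥ fun a => w ((a : ℕ) / 2) (comp a)) k
      = ∑ m ∈ Finset.range n, lam k ^ m * (w m 0 * φ k x t 0 + w m 1 * φ k x t 1) := by
  simp only [Matrix.mulVec, dotProduct, Matrix.transpose_apply, Hmat]
  rw [sum_fin_two_mul n (fun m j => lam k ^ m * φ k x t j * w m j)]
  exact Finset.sum_congr rfl fun m _ => by ring

lemma coeffSum_mulVec_apply (n : ℕ) (C : ℕ → Mat2) (μ : ℂ) (v : Fin 2 → ℂ) (i : Fin 2) :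
    (coeffSum n C μ *ᵥ v) i
      = ∑ m ∈ Finset.range n, μ ^ m * (C m i 0 * v 0 + C m i 1 * v 1) := by
  simp only [Matrix.mulVec, dotProduct, Fin.sum_univ_two, coeffSum_apply, Finset.sum_mul,
    ← Finset.sum_add_distrib]
  exact Finset.sum_congr rfl fun m _ => by ring

lemma unisolvent_iff_det_ne_zero (n : ℕ) (lam : ℕ → ℂ) (φ : ℕ → ℝ → ℝ → Fin 2 → ℂ) (x t : ℝ) :
    Unisolvent n lam (fun k => φ k x t) ↔ ((Hmat n lam φ x t)ᵀ).det ≠ 0 := by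
  constructor
  · intro hu h0
    obtain ⟨w, hw, hH⟩ := Matrix.exists_mulVec_eq_zero_iff.2 h0
    have hC := hu (fun m => Matrix.of fun _ => unpack n w m) fun k hk => by
      funext i
      have := congrFun hH ⟨k, hk⟩
      rw [show w = fun a : Fin (2 * n) => unpack n w ((a : ℕ) / 2) (comp a) from
        funext fun a => (unpack_apply w a).symm, Hmat_transpose_mulVec] at this
      rw [coeffSum_mulVec_apply]
      simpa using this
    refine hw (funext fun a => ?_)
    rw [← unpack_apply w a]
    exact congrFun (congrFun (hC ((a : ℕ) / 2) (by omega)) 0) _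
  · intro hdet C hC m hm
    ext i j
    have hz : (fun a : Fin (2 * n) => C ((a : ℕ) / 2) i (comp a)) = 0 := by
      refine Matrix.eq_zero_of_mulVec_eq_zero hdet (funext fun k => ?_)
      rw [Hmat_transpose_mulVec n lam φ x t (fun m j => C m i j)]
      have := congrFun (hC k k.2) i
      rwa [coeffSum_mulVec_apply] at this
    have := congrFun hz ⟨2 * m + j, by omega⟩
    have h1 : (2 * m + (j : ℕ)) / 2 = m := by omega
    have h2 : comp (2 * m + j) = j := by ext; simp only [comp, Fin.ofNat]; omega
    simpa [h1, h2] using this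

/-- The coefficients `S_k` of the Darboux matrix: the `i`-th rows of `S_0, …, S_{n-1}` together
solve the linear system with matrix `Hᵀ` and right hand side `D_i`. -/
def darbouxCoeff (n : ℕ) (lam : ℕ → ℂ) (φ : ℕ → ℝ → ℝ → Fin 2 → ℂ) (k : ℕ) (x t : ℝ) : Mat2 :=
  Matrix.of fun i => unpack n (((Hmat n lam φ x t)ᵀ)⁻¹ *ᵥ colD n lam φ x t i) k

/-- Moving the first row of the bordered matrix to the bottom is an even permutation. -/
lemma det_bordered (n : ℕ) (lam : ℕ → ℂ) (φ : ℕ → ℝ → ℝ → Fin 2 → ℂ) (μ : ℂ) (x t : ℝ)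
    (i j : Fin 2) (hdet : ((Hmat n lam φ x t)ᵀ).det ≠ 0) :
    (bordered n lam φ μ x t i j).det = ((Hmat n lam φ x t)ᵀ).det
      * (entryB n μ i j - rowA n μ j ⬝ᵥ (((Hmat n lam φ x t)ᵀ)⁻¹ *ᵥ colD n lam φ x t i)) := by
  set H := (Hmat n lam φ x t)ᵀ
  have h1 : ((bordered n lam φ μ x t i j).submatrix (finRotate (2 * n + 1)) id).det
      = (bordered n lam φ μ x t i j).det := by
    rw [Matrix.det_permute, sign_finRotate]
    simp
  have h2 : ((bordered n lam φ μ x t i j).submatrix (finRotate (2 * n + 1)) id).submatrix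
      finSumFinEquiv finSumFinEquiv
      = Matrix.fromBlocks H (Matrix.of fun k _ => colD n lam φ x t i k)
        (Matrix.of fun (_ : Fin 1) a => rowA n μ j a) (Matrix.of fun _ _ => entryB n μ i j) := by
    have hl : ∀ a : Fin (2 * n), finSumFinEquiv (Sum.inl a : Fin (2 * n) ⊕ Fin 1) = a.castSucc :=
      fun a => rfl
    have hr : ∀ b : Fin 1, finSumFinEquiv (Sum.inr b : Fin (2 * n) ⊕ Fin 1) = Fin.last (2 * n) :=
      fun b => by ext; simp
    have gl : ∀ a : Fin (2 * n), finRotate (2 * n + 1) a.castSucc = a.succ := fun a => by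
      rw [finRotate_apply, Fin.coeSucc_eq_succ]
    have gr : finRotate (2 * n + 1) (Fin.last (2 * n)) = 0 := by
      rw [finRotate_apply, Fin.last_add_one]
    ext a b
    rcases a with a | a <;> rcases b with b | b
    · change bordered n lam φ μ x t i j (finRotate (2 * n + 1) _) _ = H a b
      rw [hl, id, hl, gl]
      simp [bordered, H]
    · change bordered n lam φ μ x t i j (finRotate (2 * n + 1) _) _ = colD n lam φ x t i a
      rw [hl, id, hr, gl]
      simp [bordered]
    · change bordered n lam φ μ x t i j (finRotate (2 * n + 1) _) _ = rowA n μ j b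
      rw [hr, id, hl, gr]
      simp [bordered]
    · change bordered n lam φ μ x t i j (finRotate (2 * n + 1) _) _ = entryB n μ i j
      rw [hr, id, hr, gr]
      simp [bordered]
  have : Invertible H := Matrix.invertibleOfIsUnitDet H (isUnit_iff_ne_zero.2 hdet)
  rw [← h1, ← Matrix.det_submatrix_equiv_self finSumFinEquiv, h2, Matrix.det_fromBlocks₁₁]
  congr 1
  rw [Matrix.det_unique]
  rw [Matrix.mul_assoc, Matrix.sub_apply, Matrix.invOf_eq_nonsing_inv]
  rfl

/-- The ratio of determinants is a monic matrix polynomial, by Cramer's rule. -/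
lemma darbouxMatrix_eq_monicSum (n : ℕ) (lam : ℕ → ℂ) (φ : ℕ → ℝ → ℝ → Fin 2 → ℂ) (x t : ℝ)
    (hdet : ((Hmat n lam φ x t)ᵀ).det ≠ 0) (μ : ℂ) :
    darbouxMatrix n lam φ μ x t = monicSum n (fun k => darbouxCoeff n lam φ k x t) μ := by
  ext i j
  change (bordered n lam φ μ x t i j).det / ((Hmat n lam φ x t)ᵀ).det = _
  rw [det_bordered n lam φ μ x t i j hdet, mul_div_cancel_left₀ _ hdet, monicSum,
    Matrix.sub_apply, coeffSum_apply]
  congr 1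
  · simp [entryB, Matrix.one_apply]
  · set w := ((Hmat n lam φ x t)ᵀ)⁻¹ *ᵥ colD n lam φ x t i with hw
    have h1 : rowA n μ j ⬝ᵥ w = ∑ a : Fin (2 * n), (fun (m : ℕ) (l : Fin 2) =>
        if l = j then μ ^ m * unpack n w m l else 0) ((a : ℕ) / 2) (comp a) := by
      refine Finset.sum_congr rfl fun a _ => ?_
      simp only [unpack_apply, rowA, ite_mul, zero_mul]
    rw [h1, sum_fin_two_mul n (fun m l => if l = j then μ ^ m * unpack n w m l else 0)]
    refine Finset.sum_congr rfl fun m _ => ?_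
    fin_cases j <;> simp [darbouxCoeff, hw]

lemma monicSum_darbouxCoeff_mulVec (n : ℕ) (lam : ℕ → ℂ) (φ : ℕ → ℝ → ℝ → Fin 2 → ℂ) (x t : ℝ)
    (hdet : ((Hmat n lam φ x t)ᵀ).det ≠ 0) {k : ℕ} (hk : k < 2 * n) :
    monicSum n (fun m => darbouxCoeff n lam φ m x t) (lam k) *ᵥ φ k x t = 0 := by
  funext i
  rw [monicSum, Matrix.sub_mulVec, Pi.sub_apply, coeffSum_mulVec_apply, Pi.zero_apply, sub_eq_zero]
  set w := ((Hmat n lam φ x t)ᵀ)⁻¹ *ᵥ colD n lam φ x t i with hw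
  have h1 : (Hmat n lam φ x t)ᵀ *ᵥ w = colD n lam φ x t i := by
    rw [hw, Matrix.mulVec_mulVec, Matrix.mul_nonsing_inv _ (isUnit_iff_ne_zero.2 hdet),
      Matrix.one_mulVec]
  have h2 := congrFun h1 ⟨k, hk⟩
  rw [show w = fun a : Fin (2 * n) => unpack n w ((a : ℕ) / 2) (comp a) from
        funext fun a => (unpack_apply w a).symm, Hmat_transpose_mulVec] at h2
  simp only [colD] at h2
  rw [Matrix.smul_mulVec, Matrix.one_mulVec, Pi.smul_apply, smul_eq_mul, ← h2]
  rfl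

/-- The iterated one-fold transformation is a monic matrix polynomial killing the eigenfunctions
used so far. -/
lemma exists_iteratedDarboux_eq (lam : ℕ → ℂ) (φ : ℕ → ℝ → ℝ → Fin 2 → ℂ) (x t : ℝ) (n : ℕ)
    (hG : ∀ m < n, (pairMat (iteratedDarboux lam φ x t m) m lam φ x t).det ≠ 0) :
    (∃ C : ℕ → Mat2, ∀ μ, iteratedDarboux lam φ x t n μ = monicSum n C μ) ∧
    ∀ k < 2 * n, iteratedDarboux lam φ x t n (lam k) *ᵥ φ k x t = 0 := by
  induction n with
  | zero => exact ⟨⟨fun _ => 0, fun μ => by simp [iteratedDarboux, monicSum, coeffSum]⟩,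
      fun k hk => by omega⟩
  | succ n ih =>
    obtain ⟨⟨C, hC⟩, hk⟩ := ih fun m hm => hG m (by omega)
    set G := pairMat (iteratedDarboux lam φ x t n) n lam φ x t with hGdef
    set Λ : Mat2 := Matrix.diagonal ![lam (2 * n), lam (2 * n + 1)] with hΛ
    have hT : ∀ μ, iteratedDarboux lam φ x t (n + 1) μ
        = (μ • (1 : Mat2) - G * Λ * G⁻¹) * iteratedDarboux lam φ x t n μ := fun μ => rfl
    refine ⟨⟨fun k => shift C k - if k < n then G * Λ * G⁻¹ * C k else -(G * Λ * G⁻¹),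
      fun μ => ?_⟩, fun k hk' => ?_⟩
    · have h1 : coeffSum (n + 1) (shift C) μ = μ • coeffSum n C μ := by
        simp [coeffSum, Finset.sum_range_succ', shift, Finset.smul_sum, smul_smul, pow_succ']
      have h2 : coeffSum (n + 1) (fun k => if k < n then G * Λ * G⁻¹ * C k else -(G * Λ * G⁻¹)) μ
          = G * Λ * G⁻¹ * coeffSum n C μ - μ ^ n • (G * Λ * G⁻¹) := by
        rw [← coeffSum_mul_left, coeffSum, Finset.sum_range_succ, sub_eq_add_neg]
        congr 1
        · exact coeffSum_congr (fun k hk => by simp [hk]) μ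
        · simp
      rw [hT, hC, monicSum, monicSum, coeffSum_sub, h1, h2]
      simp only [sub_mul, mul_sub, smul_mul_assoc, one_mul, mul_smul_comm, mul_one]
      module
    · rw [hT, ← Matrix.mulVec_mulVec]
      rcases lt_or_ge k (2 * n) with h | h
      · rw [hk k h, Matrix.mulVec_zero]
      · have hcol : ∀ c : Fin 2, iteratedDarboux lam φ x t n (lam (2 * n + c))
            *ᵥ φ (2 * n + c) x t = G *ᵥ Pi.single c 1 := fun c => by
          rw [Matrix.mulVec_single_one]; rfl
        have hinv : G⁻¹ * G = 1 :=
          Matrix.nonsing_inv_mul _ (isUnit_iff_ne_zero.2 (hG n (by omega)))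
        obtain ⟨c, rfl⟩ : ∃ c : Fin 2, k = 2 * n + c :=
          ⟨⟨k - 2 * n, by omega⟩, by simp; omega⟩
        have hΛc : Λ *ᵥ Pi.single c 1 = lam (2 * n + c) • Pi.single c 1 := by
          rw [hΛ, Matrix.diagonal_mulVec_single]
          fin_cases c <;> simp [← Pi.single_smul]
        rw [hcol, Matrix.sub_mulVec, Matrix.mulVec_mulVec _ (G * Λ * G⁻¹), Matrix.mul_assoc, hinv,
          Matrix.mul_one, ← Matrix.mulVec_mulVec, hΛc, Matrix.mulVec_smul, Matrix.smul_mulVec,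
          Matrix.one_mulVec, sub_self]

/-- Uniqueness of interpolation under the non-degeneracy conditions of the iteration. A polynomial
of degree at most `n` killing the first `2n + 2` eigenfunctions is divided by the `n`-fold Darboux
matrix; the remainder vanishes by induction, and the constant quotient kills the two independent
columns of the `n`-th pair matrix. -/
lemma unisolvent_of_pairMat (lam : ℕ → ℂ) (φ : ℕ → ℝ → ℝ → Fin 2 → ℂ) (x t : ℝ) (n : ℕ)
    (hG : ∀ m < n, (pairMat (iteratedDarboux lam φ x t m) m lam φ x t).det ≠ 0) :
    Unisolvent n lam (fun k => φ k x t) := by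
  induction n with
  | zero => exact fun C _ m hm => by omega
  | succ n ih =>
    intro W hW
    obtain ⟨⟨C, hC⟩, hk⟩ := exists_iteratedDarboux_eq lam φ x t n fun m hm => hG m (by omega)
    have hdiv : ∀ μ, coeffSum (n + 1) W μ
        = W n * iteratedDarboux lam φ x t n μ + coeffSum n (fun k => W k + W n * C k) μ := by
      intro μ
      rw [hC, monicSum, coeffSum_add, coeffSum_mul_left, mul_sub, mul_smul_comm, mul_one]
      simp only [coeffSum, Finset.sum_range_succ]
      abel
    have hrem := ih (fun m hm => hG m (by omega)) (fun k => W k + W n * C k) fun k hk' => by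
      have := hW k (by omega)
      rwa [hdiv, Matrix.add_mulVec, ← Matrix.mulVec_mulVec, hk k hk', Matrix.mulVec_zero,
        zero_add] at this
    have hz : ∀ μ, coeffSum n (fun k => W k + W n * C k) μ = 0 := fun μ => by
      rw [coeffSum_congr hrem]; simp [coeffSum]
    have hWG : W n * pairMat (iteratedDarboux lam φ x t n) n lam φ x t = 0 := by
      ext i c
      have := congrFun (hW (2 * n + c) (by omega)) i
      rw [hdiv, hz, add_zero, ← Matrix.mulVec_mulVec] at this
      exact this
    have hWn : W n = 0 := by
      have h := congrArg (· * (pairMat (iteratedDarboux lam φ x t n) n lam φ x t)⁻¹) hWG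
      simpa [Matrix.mul_assoc, Matrix.mul_nonsing_inv _
        (isUnit_iff_ne_zero.2 (hG n (by omega)))] using h
    intro m hm
    rcases Nat.lt_succ_iff_lt_or_eq.1 hm with h | rfl
    · simpa [hWn] using hrem m h
    · exact hWn

/-- The iterated one-fold transformation is the ratio of determinants. -/
lemma iteratedDarboux_eq_darbouxMatrix (lam : ℕ → ℂ) (φ : ℕ → ℝ → ℝ → Fin 2 → ℂ) (x t : ℝ) (n : ℕ)
    (hG : ∀ m < n, (pairMat (iteratedDarboux lam φ x t m) m lam φ x t).det ≠ 0) :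
    ((Hmat n lam φ x t)ᵀ).det ≠ 0 ∧
      ∀ μ, iteratedDarboux lam φ x t n μ = darbouxMatrix n lam φ μ x t := by
  have hu := unisolvent_of_pairMat lam φ x t n hG
  have hdet := (unisolvent_iff_det_ne_zero n lam φ x t).1 hu
  refine ⟨hdet, fun μ => ?_⟩
  obtain ⟨⟨C, hC⟩, hk⟩ := exists_iteratedDarboux_eq lam φ x t n hG
  rw [hC, darbouxMatrix_eq_monicSum n lam φ x t hdet, monicSum, monicSum]
  congr 1
  exact coeffSum_congr (fun m hm => hu.eq_of_monicSum_mulVec (fun k hk' => by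
    rw [← hC]; exact hk k hk')
    (fun k hk' => monicSum_darbouxCoeff_mulVec n lam φ x t hdet hk') hm) μ

/-! ### Entrywise derivatives and the Lax pair -/

/-- Entrywise differentiability of a matrix valued function of a real variable. -/
def HasMatDeriv (A : ℝ → Mat2) (A' : Mat2) (s : ℝ) : Prop :=
  ∀ i j, HasDerivAt (fun u => A u i j) (A' i j) s

namespace HasMatDeriv

variable {A B : ℝ → Mat2} {A' B' : Mat2} {s : ℝ}

lemma add (hA : HasMatDeriv A A' s) (hB : HasMatDeriv B B' s) :
    HasMatDeriv (fun u => A u + B u) (A' + B') s :=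
  fun i j => (hA i j).add (hB i j)

lemma sub (hA : HasMatDeriv A A' s) (hB : HasMatDeriv B B' s) :
    HasMatDeriv (fun u => A u - B u) (A' - B') s :=
  fun i j => (hA i j).sub (hB i j)

lemma const (A : Mat2) : HasMatDeriv (fun _ => A) 0 s :=
  fun i j => hasDerivAt_const s (A i j)

lemma mul (hA : HasMatDeriv A A' s) (hB : HasMatDeriv B B' s) :
    HasMatDeriv (fun u => A u * B u) (A' * B s + A s * B') s := by
  intro i j
  simp only [Matrix.mul_apply, Matrix.add_apply, Fin.sum_univ_two]
  exact (((hA i 0).mul (hB 0 j)).add ((hA i 1).mul (hB 1 j))).congr_deriv (by ring)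

lemma const_mul (K : Mat2) (hA : HasMatDeriv A A' s) :
    HasMatDeriv (fun u => K * A u) (K * A') s := by
  simpa using (const K).mul hA

lemma mul_const (hA : HasMatDeriv A A' s) (K : Mat2) :
    HasMatDeriv (fun u => A u * K) (A' * K) s := by
  simpa using hA.mul (const K)

lemma mulVec {v : ℝ → Fin 2 → ℂ} {v' : Fin 2 → ℂ} (hA : HasMatDeriv A A' s)
    (hv : HasDerivAt v v' s) :
    HasDerivAt (fun u => A u *ᵥ v u) (A' *ᵥ v s + A s *ᵥ v') s := by
  rw [hasDerivAt_pi] at hv ⊢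
  intro i
  simp only [Matrix.mulVec, dotProduct, Pi.add_apply, Fin.sum_univ_two]
  exact (((hA i 0).mul (hv 0)).add ((hA i 1).mul (hv 1))).congr_deriv (by ring)

lemma coeffSum {C : ℕ → ℝ → Mat2} {D : ℕ → Mat2} (h : ∀ k, HasMatDeriv (C k) (D k) s) (n : ℕ)
    (μ : ℂ) : HasMatDeriv (fun u => coeffSum n (fun k => C k u) μ) (coeffSum n D μ) s := by
  intro i j
  simp only [coeffSum_apply]
  exact HasDerivAt.fun_sum fun k _ => (h k i j).const_mul _

lemma monicSum {C : ℕ → ℝ → Mat2} {D : ℕ → Mat2} (h : ∀ k, HasMatDeriv (C k) (D k) s) (n : ℕ)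
    (μ : ℂ) : HasMatDeriv (fun u => monicSum n (fun k => C k u) μ) (-NHMB.coeffSum n D μ) s := by
  simpa [NHMB.monicSum] using (const (μ ^ n • (1 : Mat2))).sub (coeffSum h n μ)

lemma shift {C : ℕ → ℝ → Mat2} {D : ℕ → Mat2} (h : ∀ k, HasMatDeriv (C k) (D k) s) (m : ℕ) :
    HasMatDeriv (fun u => shift (fun k => C k u) m) (NHMB.shift D m) s := by
  cases m with
  | zero => exact const 0
  | succ m => exact h m

lemma eq_of_eqOn {I : Set ℝ} (hI : IsOpen I) (hs : s ∈ I) (h : ∀ u ∈ I, A u = B u)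
    (hA : HasMatDeriv A A' s) (hB : HasMatDeriv B B' s) : A' = B' := by
  ext i j
  refine (hA i j).unique ((hB i j).congr_of_eventuallyEq ?_)
  filter_upwards [hI.mem_nhds hs] with u hu
  rw [h u hu]

end HasMatDeriv

/-- The leading coefficient `-i σ₃` of the AKNS matrix. -/
def sigmaK : Mat2 := !![-Complex.I, 0; 0, Complex.I]

/-- The off-diagonal matrix of the potentials. -/
def offMat (q r : ℂ) : Mat2 := !![0, q; r, 0]

/-- The coefficients of `N` without its pole, in terms of the values of the potentials and of
their first two time derivatives. -/
def laxCoeff (α β q q₁ q₂ r r₁ r₂ : ℂ) : Fin 4 → Mat2 :=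
  ![!![β * (q * r₁ - r * q₁) - Complex.I / 2 * α * q * r,
      β * (q₂ - 2 * q ^ 2 * r) + Complex.I / 2 * α * q₁;
      β * (r₂ - 2 * q * r ^ 2) - Complex.I / 2 * α * r₁,
      -β * (q * r₁ - r * q₁) + Complex.I / 2 * α * q * r],
    !![2 * Complex.I * β * q * r, -2 * Complex.I * β * q₁ + α * q;
      2 * Complex.I * β * r₁ + α * r, -2 * Complex.I * β * q * r],
    !![-Complex.I * α, -4 * β * q; -4 * β * r, Complex.I * α],
    !![4 * Complex.I * β, 0; 0, -4 * Complex.I * β]]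

/-- The residue matrix of the pole of `N`. -/
def poleMat (δ p m η : ℂ) : Mat2 := !![η, -δ * p; -δ * m, -η]

/-- The coefficients of `M`, seen as a cubic with vanishing top coefficients. -/
def aknsCoeff (Q : Mat2) : Fin 4 → Mat2 := ![Q, sigmaK, 0, 0]

lemma laxM_eq_cubic (q r : ℝ → ℝ → ℂ) (μ : ℂ) (x t : ℝ) :
    laxM q r μ x t = cubic (aknsCoeff (offMat (q x t) (r x t))) 0 0 μ := by
  ext i j
  fin_cases i <;> fin_cases j <;> simp [laxM, cubic, aknsCoeff, offMat, sigmaK, mul_comm]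

/-- The time derivative of the coefficient `S` of a Darboux matrix, `S'` being the next one. -/
def timeRHS (U V S S' : Mat2) : Mat2 := V * S - S * U + (sigmaK * S' - S' * sigmaK)

/-- The derivative of `timeRHS` by the product rule: `U₁`, `V₁`, `D`, `D'` are the derivatives of
`U`, `V`, `S`, `S'`. -/
def timeRHS₂ (U U₁ V V₁ S D D' : Mat2) : Mat2 :=
  V₁ * S + V * D - (D * U + S * U₁) + (sigmaK * D' - D' * sigmaK)

/-- The derivative of `timeRHS₂`; here `D₂`, `D₂'` are second derivatives. -/
def timeRHS₃ (U U₁ U₂ V V₁ V₂ S D D₂ D₂' : Mat2) : Mat2 :=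
  V₂ * S + V₁ * D + (V₁ * D + V * D₂) - (D₂ * U + D * U₁ + (D * U₁ + S * U₂))
    + (sigmaK * D₂' - D₂' * sigmaK)

/-- The relations between the old potentials `U`, the new potentials `V`, their time derivatives,
and the top coefficients `S₁, …, S₄` of the Darboux matrix. They express `S₂, S₃, S₄`, up to their
diagonals, by the potentials. -/
structure JetRel (U U₁ U₂ U₃ V V₁ V₂ V₃ S₁ S₂ S₃ S₄ : Mat2) : Prop where
  zero : V - U = sigmaK * S₁ - S₁ * sigmaK
  one : V₁ - U₁ = sigmaK * timeRHS U V S₁ S₂ - timeRHS U V S₁ S₂ * sigmaK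
  two : V₂ - U₂ = sigmaK * timeRHS₂ U U₁ V V₁ S₁ (timeRHS U V S₁ S₂) (timeRHS U V S₂ S₃)
      - timeRHS₂ U U₁ V V₁ S₁ (timeRHS U V S₁ S₂) (timeRHS U V S₂ S₃) * sigmaK
  three : V₃ - U₃ =
      sigmaK * timeRHS₃ U U₁ U₂ V V₁ V₂ S₁ (timeRHS U V S₁ S₂)
        (timeRHS₂ U U₁ V V₁ S₁ (timeRHS U V S₁ S₂) (timeRHS U V S₂ S₃))
        (timeRHS₂ U U₁ V V₁ S₂ (timeRHS U V S₂ S₃) (timeRHS U V S₃ S₄))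
      - timeRHS₃ U U₁ U₂ V V₁ V₂ S₁ (timeRHS U V S₁ S₂)
        (timeRHS₂ U U₁ V V₁ S₁ (timeRHS U V S₁ S₂) (timeRHS U V S₂ S₃))
        (timeRHS₂ U U₁ V V₁ S₂ (timeRHS U V S₂ S₃) (timeRHS U V S₃ S₄)) * sigmaK

lemma HasMatDeriv.commSigma {A : ℝ → Mat2} {A' : Mat2} {s : ℝ} (h : HasMatDeriv A A' s) :
    HasMatDeriv (fun u => sigmaK * A u - A u * sigmaK) (sigmaK * A' - A' * sigmaK) s :=
  (h.const_mul _).sub (h.mul_const _)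

/-- The jet relations follow from the zeroth one and the time evolution of the coefficients by
differentiating three times. -/
lemma jetRel_of_hasMatDeriv {I : Set ℝ} (hI : IsOpen I)
    {U U₁ U₂ U₃ V V₁ V₂ V₃ S₁ S₂ S₃ S₄ : ℝ → Mat2}
    (hU : ∀ s ∈ I, HasMatDeriv U (U₁ s) s) (hU₁ : ∀ s ∈ I, HasMatDeriv U₁ (U₂ s) s)
    (hU₂ : ∀ s ∈ I, HasMatDeriv U₂ (U₃ s) s)
    (hV : ∀ s ∈ I, HasMatDeriv V (V₁ s) s) (hV₁ : ∀ s ∈ I, HasMatDeriv V₁ (V₂ s) s)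
    (hV₂ : ∀ s ∈ I, HasMatDeriv V₂ (V₃ s) s)
    (hS₁ : ∀ s ∈ I, HasMatDeriv S₁ (timeRHS (U s) (V s) (S₁ s) (S₂ s)) s)
    (hS₂ : ∀ s ∈ I, HasMatDeriv S₂ (timeRHS (U s) (V s) (S₂ s) (S₃ s)) s)
    (hS₃ : ∀ s ∈ I, HasMatDeriv S₃ (timeRHS (U s) (V s) (S₃ s) (S₄ s)) s)
    (h0 : ∀ s ∈ I, V s - U s = sigmaK * S₁ s - S₁ s * sigmaK) {s : ℝ} (hs : s ∈ I) :
    JetRel (U s) (U₁ s) (U₂ s) (U₃ s) (V s) (V₁ s) (V₂ s) (V₃ s) (S₁ s) (S₂ s) (S₃ s) (S₄ s) := by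
  have hD₁ : ∀ s ∈ I, HasMatDeriv (fun u => timeRHS (U u) (V u) (S₁ u) (S₂ u))
      (timeRHS₂ (U s) (U₁ s) (V s) (V₁ s) (S₁ s) (timeRHS (U s) (V s) (S₁ s) (S₂ s))
        (timeRHS (U s) (V s) (S₂ s) (S₃ s))) s := fun s hs =>
    (((hV s hs).mul (hS₁ s hs)).sub ((hS₁ s hs).mul (hU s hs))).add (hS₂ s hs).commSigma
  have hD₂ : ∀ s ∈ I, HasMatDeriv (fun u => timeRHS (U u) (V u) (S₂ u) (S₃ u))
      (timeRHS₂ (U s) (U₁ s) (V s) (V₁ s) (S₂ s) (timeRHS (U s) (V s) (S₂ s) (S₃ s))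
        (timeRHS (U s) (V s) (S₃ s) (S₄ s))) s := fun s hs =>
    (((hV s hs).mul (hS₂ s hs)).sub ((hS₂ s hs).mul (hU s hs))).add (hS₃ s hs).commSigma
  have hD₁₁ : ∀ s ∈ I, HasMatDeriv (fun u => timeRHS₂ (U u) (U₁ u) (V u) (V₁ u) (S₁ u)
      (timeRHS (U u) (V u) (S₁ u) (S₂ u)) (timeRHS (U u) (V u) (S₂ u) (S₃ u)))
      (timeRHS₃ (U s) (U₁ s) (U₂ s) (V s) (V₁ s) (V₂ s) (S₁ s)
        (timeRHS (U s) (V s) (S₁ s) (S₂ s))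
        (timeRHS₂ (U s) (U₁ s) (V s) (V₁ s) (S₁ s) (timeRHS (U s) (V s) (S₁ s) (S₂ s))
          (timeRHS (U s) (V s) (S₂ s) (S₃ s)))
        (timeRHS₂ (U s) (U₁ s) (V s) (V₁ s) (S₂ s) (timeRHS (U s) (V s) (S₂ s) (S₃ s))
          (timeRHS (U s) (V s) (S₃ s) (S₄ s)))) s := fun s hs =>
    ((((hV₁ s hs).mul (hS₁ s hs)).add ((hV s hs).mul (hD₁ s hs))).sub
      (((hD₁ s hs).mul (hU s hs)).add ((hS₁ s hs).mul (hU₁ s hs)))).add (hD₂ s hs).commSigma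
  have h1 : ∀ s ∈ I, V₁ s - U₁ s = _ := fun s hs =>
    HasMatDeriv.eq_of_eqOn hI hs h0 ((hV s hs).sub (hU s hs)) (hS₁ s hs).commSigma
  have h2 : ∀ s ∈ I, V₂ s - U₂ s = _ := fun s hs =>
    HasMatDeriv.eq_of_eqOn hI hs h1 ((hV₁ s hs).sub (hU₁ s hs)) (hD₁ s hs).commSigma
  exact ⟨h0 s hs, h1 s hs, h2 s hs,
    HasMatDeriv.eq_of_eqOn hI hs h2 ((hV₂ s hs).sub (hU₂ s hs)) (hD₁₁ s hs).commSigma⟩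

/-! ### Polynomial identities between old and new potentials -/

lemma mat2_mul_apply (A B : Mat2) (i j : Fin 2) :
    (A * B) i j = A i 0 * B 0 j + A i 1 * B 1 j := by
  rw [Matrix.mul_apply, Fin.sum_univ_two]

lemma mat2_ext_iff {A B : Mat2} :
    A = B ↔ (A 0 0 = B 0 0 ∧ A 0 1 = B 0 1) ∧ A 1 0 = B 1 0 ∧ A 1 1 = B 1 1 := by
  rw [← Matrix.ext_iff]
  simp only [Fin.forall_fin_two]

lemma offMat_entries (q r : ℂ) :
    offMat q r 0 0 = 0 ∧ offMat q r 0 1 = q ∧ offMat q r 1 0 = r ∧ offMat q r 1 1 = 0 :=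
  ⟨rfl, rfl, rfl, rfl⟩

lemma sigmaK_entries :
    sigmaK 0 0 = -Complex.I ∧ sigmaK 0 1 = 0 ∧ sigmaK 1 0 = 0 ∧ sigmaK 1 1 = Complex.I :=
  ⟨rfl, rfl, rfl, rfl⟩

lemma laxCoeff_zero_entries (α β q q₁ q₂ r r₁ r₂ : ℂ) :
    laxCoeff α β q q₁ q₂ r r₁ r₂ 0 0 0 = β * (q * r₁ - r * q₁) - Complex.I / 2 * α * q * r ∧
    laxCoeff α β q q₁ q₂ r r₁ r₂ 0 0 1
      = β * (q₂ - 2 * q ^ 2 * r) + Complex.I / 2 * α * q₁ ∧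
    laxCoeff α β q q₁ q₂ r r₁ r₂ 0 1 0
      = β * (r₂ - 2 * q * r ^ 2) - Complex.I / 2 * α * r₁ ∧
    laxCoeff α β q q₁ q₂ r r₁ r₂ 0 1 1
      = -β * (q * r₁ - r * q₁) + Complex.I / 2 * α * q * r :=
  ⟨rfl, rfl, rfl, rfl⟩

lemma laxCoeff_one_entries (α β q q₁ q₂ r r₁ r₂ : ℂ) :
    laxCoeff α β q q₁ q₂ r r₁ r₂ 1 0 0 = 2 * Complex.I * β * q * r ∧
    laxCoeff α β q q₁ q₂ r r₁ r₂ 1 0 1 = -2 * Complex.I * β * q₁ + α * q ∧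
    laxCoeff α β q q₁ q₂ r r₁ r₂ 1 1 0 = 2 * Complex.I * β * r₁ + α * r ∧
    laxCoeff α β q q₁ q₂ r r₁ r₂ 1 1 1 = -2 * Complex.I * β * q * r :=
  ⟨rfl, rfl, rfl, rfl⟩

lemma laxCoeff_two_entries (α β q q₁ q₂ r r₁ r₂ : ℂ) :
    laxCoeff α β q q₁ q₂ r r₁ r₂ 2 0 0 = -Complex.I * α ∧
    laxCoeff α β q q₁ q₂ r r₁ r₂ 2 0 1 = -4 * β * q ∧
    laxCoeff α β q q₁ q₂ r r₁ r₂ 2 1 0 = -4 * β * r ∧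
    laxCoeff α β q q₁ q₂ r r₁ r₂ 2 1 1 = Complex.I * α :=
  ⟨rfl, rfl, rfl, rfl⟩

lemma laxCoeff_three_entries (α β q q₁ q₂ r r₁ r₂ : ℂ) :
    laxCoeff α β q q₁ q₂ r r₁ r₂ 3 0 0 = 4 * Complex.I * β ∧
    laxCoeff α β q q₁ q₂ r r₁ r₂ 3 0 1 = 0 ∧
    laxCoeff α β q q₁ q₂ r r₁ r₂ 3 1 0 = 0 ∧
    laxCoeff α β q q₁ q₂ r r₁ r₂ 3 1 1 = -4 * Complex.I * β :=
  ⟨rfl, rfl, rfl, rfl⟩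

lemma offMat_sub_eq_commSigma_iff (q r Q R : ℂ) (S : Mat2) :
    offMat Q R - offMat q r = sigmaK * S - S * sigmaK
      ↔ q = Q + 2 * Complex.I * S 0 1 ∧ r = R - 2 * Complex.I * S 1 0 := by
  rw [mat2_ext_iff]
  simp only [offMat_entries, sigmaK_entries, mat2_mul_apply, Matrix.sub_apply]
  constructor
  · rintro ⟨⟨-, h1⟩, h2, -⟩
    exact ⟨by linear_combination -h1, by linear_combination -h2⟩
  · rintro ⟨h1, h2⟩
    exact ⟨⟨by ring, by linear_combination -h1⟩, by linear_combination -h2, by ring⟩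

lemma TopMatch.akns {q r Q R : ℂ} {S₁ S₂ S₃ : Mat2}
    (h : offMat Q R - offMat q r = sigmaK * S₁ - S₁ * sigmaK) :
    TopMatch (aknsCoeff (offMat q r)) (aknsCoeff (offMat Q R)) S₁ S₂ S₃ where
  three := rfl
  two := by simp [aknsCoeff]
  one := by simp [aknsCoeff]
  zero := by
    simp only [aknsCoeff]
    simp
    linear_combination (norm := module) (-1 : ℂ) • h

section
variable {q q₁ q₂ q₃ r r₁ r₂ r₃ Q Q₁ Q₂ Q₃ R R₁ R₂ R₃ : ℂ} {S₁ S₂ S₃ S₄ : Mat2}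

/-- After eliminating the old potentials by the jet relations, the degree conditions for `N` are
polynomial identities. -/
lemma JetRel.topMatch
    (h : JetRel (offMat q r) (offMat q₁ r₁) (offMat q₂ r₂) (offMat q₃ r₃)
      (offMat Q R) (offMat Q₁ R₁) (offMat Q₂ R₂) (offMat Q₃ R₃) S₁ S₂ S₃ S₄) (α β : ℂ) :
    TopMatch (laxCoeff α β q q₁ q₂ r r₁ r₂) (laxCoeff α β Q Q₁ Q₂ R R₁ R₂) S₁ S₂ S₃ := by
  -- The relations are solved for the old potentials, which needs no division.
  obtain ⟨h0, h1, h2, -⟩ := h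
  rw [offMat_sub_eq_commSigma_iff] at h0 h1 h2
  simp only [timeRHS, timeRHS₂, mat2_mul_apply, Matrix.sub_apply, Matrix.add_apply,
    offMat_entries, sigmaK_entries] at h0 h1 h2
  obtain ⟨rfl, rfl⟩ := h0
  obtain ⟨rfl, rfl⟩ := h1
  obtain ⟨rfl, rfl⟩ := h2
  have hI : Complex.I ^ 2 = -1 := Complex.I_sq
  have hI3 : Complex.I ^ 3 = -Complex.I := Complex.I_pow_three
  constructor
  all_goals
    rw [mat2_ext_iff]
    simp only [laxCoeff_zero_entries, laxCoeff_one_entries, laxCoeff_two_entries,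
      laxCoeff_three_entries, mat2_mul_apply, Matrix.sub_apply, Matrix.zero_apply]
    generalize Complex.I = ι at hI hI3
    refine ⟨⟨?_, ?_⟩, ?_, ?_⟩
  all_goals
    first
    | trivial
    | ring1
    | (ring_nf; simp only [hI, hI3]; ring1)

/-- The evolution of the top coefficient in `x` carries the first equation of the system from the
old to the new potentials. Here `D` is the `x`-derivative of `S₁`, given by its evolution equation.
After eliminating the old potentials by the jet relations, a polynomial identity is left. -/
lemma JetRel.evolution_identity
    (h : JetRel (offMat q r) (offMat q₁ r₁) (offMat q₂ r₂) (offMat q₃ r₃)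
      (offMat Q R) (offMat Q₁ R₁) (offMat Q₂ R₂) (offMat Q₃ R₃) S₁ S₂ S₃ S₄) {α β δ : ℂ}
    {D : Mat2} {p m η p' m' η' q_x : ℂ}
    (hD : D = (laxCoeff α β Q Q₁ Q₂ R R₁ R₂ 0 * S₁ - S₁ * laxCoeff α β q q₁ q₂ r r₁ r₂ 0)
      + (laxCoeff α β Q Q₁ Q₂ R R₁ R₂ 1 * S₂ - S₂ * laxCoeff α β q q₁ q₂ r r₁ r₂ 1)
      + (laxCoeff α β Q Q₁ Q₂ R R₁ R₂ 2 * S₃ - S₃ * laxCoeff α β q q₁ q₂ r r₁ r₂ 2)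
      + (laxCoeff α β Q Q₁ Q₂ R R₁ R₂ 3 * S₄ - S₄ * laxCoeff α β q q₁ q₂ r r₁ r₂ 3)
      + Complex.I • (poleMat δ p m η - poleMat δ p' m' η'))
    (hq : q_x = β * (q₃ - 6 * q * r * q₁) + Complex.I / 2 * α * (q₂ - 2 * q ^ 2 * r) + 2 * δ * p) :
    q_x - 2 * Complex.I * D 0 1
      = β * (Q₃ - 6 * Q * R * Q₁) + Complex.I / 2 * α * (Q₂ - 2 * Q ^ 2 * R) + 2 * δ * p' := by
  obtain ⟨h0, h1, h2, h3⟩ := h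
  rw [offMat_sub_eq_commSigma_iff] at h0 h1 h2 h3
  simp only [timeRHS, timeRHS₂, timeRHS₃, mat2_mul_apply, Matrix.sub_apply, Matrix.add_apply,
    offMat_entries, sigmaK_entries] at h0 h1 h2 h3
  obtain ⟨rfl, rfl⟩ := h0
  obtain ⟨rfl, rfl⟩ := h1
  obtain ⟨rfl, rfl⟩ := h2
  obtain ⟨rfl, -⟩ := h3
  have hp : ∀ p m η : ℂ, poleMat δ p m η 0 1 = -δ * p := fun _ _ _ => rfl
  have hI : Complex.I ^ 2 = -1 := Complex.I_sq
  have hI3 : Complex.I ^ 3 = -Complex.I := Complex.I_pow_three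
  have hI4 : Complex.I ^ 4 = 1 := Complex.I_pow_four
  rw [hq, hD]
  simp only [laxCoeff_zero_entries, laxCoeff_one_entries, laxCoeff_two_entries,
      laxCoeff_three_entries, mat2_mul_apply, Matrix.sub_apply, Matrix.add_apply,
      Matrix.smul_apply, smul_eq_mul, hp]
  generalize Complex.I = ι at hI hI3 hI4
  ring_nf
  simp only [hI, hI3, hI4]
  ring1

end

/-! ### Smoothness -/

namespace SmoothOn

variable {U : Set (ℝ × ℝ)} {f g : ℝ → ℝ → ℂ}

lemma mono {V : Set (ℝ × ℝ)} (hf : SmoothOn U f) (h : V ⊆ U) : SmoothOn V f :=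
  ContDiffOn.mono hf h

lemma const (c : ℂ) : SmoothOn U (fun _ _ => c) := contDiffOn_const

lemma add (hf : SmoothOn U f) (hg : SmoothOn U g) : SmoothOn U (fun x t => f x t + g x t) :=
  ContDiffOn.add hf hg

lemma sub (hf : SmoothOn U f) (hg : SmoothOn U g) : SmoothOn U (fun x t => f x t - g x t) :=
  ContDiffOn.sub hf hg

lemma mul (hf : SmoothOn U f) (hg : SmoothOn U g) : SmoothOn U (fun x t => f x t * g x t) :=
  ContDiffOn.mul hf hg

lemma const_mul (c : ℂ) (hf : SmoothOn U f) : SmoothOn U (fun x t => c * f x t) :=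
  (const c).mul hf

lemma pow (hf : SmoothOn U f) (n : ℕ) : SmoothOn U (fun x t => f x t ^ n) :=
  ContDiffOn.pow hf n

lemma div (hf : SmoothOn U f) (hg : SmoothOn U g) (h : ∀ x t, (x, t) ∈ U → g x t ≠ 0) :
    SmoothOn U (fun x t => f x t / g x t) := by
  exact (ContDiffOn.mul hf (ContDiffOn.inv hg fun z hz => h z.1 z.2 hz)).congr
    fun z hz => div_eq_mul_inv _ _

lemma sum {ι : Type*} (s : Finset ι) {F : ι → ℝ → ℝ → ℂ} (h : ∀ i ∈ s, SmoothOn U (F i)) :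
    SmoothOn U (fun x t => ∑ i ∈ s, F i x t) :=
  ContDiffOn.sum (fun i hi => h i hi)

lemma prod {ι : Type*} (s : Finset ι) {F : ι → ℝ → ℝ → ℂ} (h : ∀ i ∈ s, SmoothOn U (F i)) :
    SmoothOn U (fun x t => ∏ i ∈ s, F i x t) :=
  contDiffOn_prod (fun i hi => h i hi)

lemma congr (hf : SmoothOn U f) (h : ∀ x t, (x, t) ∈ U → g x t = f x t) : SmoothOn U g :=
  ContDiffOn.congr hf fun z hz => h z.1 z.2 hz

lemma conj_neg (hU : IsPTDomain U) (hf : SmoothOn U f) : SmoothOn U (pt f) := by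
  have h1 : ContDiffOn ℝ (⊤ : ℕ∞) (fun z : ℝ × ℝ => ((-z.1, z.2) : ℝ × ℝ)) U :=
    (contDiff_fst.neg.prodMk contDiff_snd).contDiffOn
  have h2 := ContDiffOn.comp hf h1 fun z hz => hU.symm z.1 z.2 hz
  exact Complex.conjCLE.contDiff.comp_contDiffOn h2

lemma hasFDerivAt (hU : IsOpen U) (hf : SmoothOn U f) {x t : ℝ} (h : (x, t) ∈ U) :
    HasFDerivAt (fun z : ℝ × ℝ => f z.1 z.2) (fderiv ℝ (fun z : ℝ × ℝ => f z.1 z.2) (x, t))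
      (x, t) :=
  ((ContDiffOn.contDiffAt hf (hU.mem_nhds h)).differentiableAt (by simp)).hasFDerivAt

lemma hasDerivAt_snd (hU : IsOpen U) (hf : SmoothOn U f) {x t : ℝ} (h : (x, t) ∈ U) :
    HasDerivAt (fun s => f x s) (fderiv ℝ (fun z : ℝ × ℝ => f z.1 z.2) (x, t) (0, 1)) t :=
  (hf.hasFDerivAt hU h).comp_hasDerivAt t ((hasDerivAt_const t x).prodMk (hasDerivAt_id t))

lemma hasDerivAt_fst (hU : IsOpen U) (hf : SmoothOn U f) {x t : ℝ} (h : (x, t) ∈ U) :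
    HasDerivAt (fun y => f y t) (fderiv ℝ (fun z : ℝ × ℝ => f z.1 z.2) (x, t) (1, 0)) x :=
  HasFDerivAt.comp_hasDerivAt (f := fun y : ℝ => (y, t)) x (hf.hasFDerivAt hU h)
    ((hasDerivAt_id x).prodMk (hasDerivAt_const x t))

lemma hasDerivAt_dt (hU : IsOpen U) (hf : SmoothOn U f) {x t : ℝ} (h : (x, t) ∈ U) :
    HasDerivAt (fun s => f x s) (dt f x t) t :=
  (hf.hasDerivAt_snd hU h).differentiableAt.hasDerivAt

lemma hasDerivAt_dx (hU : IsOpen U) (hf : SmoothOn U f) {x t : ℝ} (h : (x, t) ∈ U) :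
    HasDerivAt (fun y => f y t) (dx f x t) x :=
  (hf.hasDerivAt_fst hU h).differentiableAt.hasDerivAt

lemma dt (hU : IsOpen U) (hf : SmoothOn U f) : SmoothOn U (dt f) := by
  have h1 : ContDiffOn ℝ (⊤ : ℕ∞) (fderiv ℝ (fun z : ℝ × ℝ => f z.1 z.2)) U :=
    ContDiffOn.fderiv_of_isOpen hf hU (by simp)
  exact (h1.clm_apply contDiffOn_const).congr fun z hz => (hf.hasDerivAt_snd hU hz).deriv

lemma det {m : ℕ} {A : ℝ → ℝ → Matrix (Fin m) (Fin m) ℂ}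
    (h : ∀ i j, SmoothOn U (fun x t => A x t i j)) : SmoothOn U (fun x t => (A x t).det) := by
  simp only [Matrix.det_apply']
  exact sum _ fun τ _ => const_mul _ (prod _ fun i _ => h _ _)

end SmoothOn

section
variable {n : ℕ} {U : Set (ℝ × ℝ)} {lam : ℕ → ℂ} {φ : ℕ → ℝ → ℝ → Fin 2 → ℂ}

lemma smoothOn_Hmat_entry (hφ : ∀ k < 2 * n, ∀ i, SmoothOn U (fun x t => φ k x t i))
    (a k : Fin (2 * n)) : SmoothOn U (fun x t => (Hmat n lam φ x t)ᵀ k a) :=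
  SmoothOn.const_mul _ (hφ k k.2 _)

lemma isOpen_regularSet (hU : IsOpen U)
    (hφ : ∀ k < 2 * n, ∀ i, SmoothOn U (fun x t => φ k x t i)) :
    IsOpen (regularSet n U lam φ) := by
  have h : SmoothOn U (fun x t => ((Hmat n lam φ x t)ᵀ).det) :=
    SmoothOn.det fun k a => smoothOn_Hmat_entry hφ a k
  exact (ContDiffOn.continuousOn h).isOpen_inter_preimage hU isOpen_compl_singleton

lemma smoothOn_darbouxCoeff (hφ : ∀ k < 2 * n, ∀ i, SmoothOn U (fun x t => φ k x t i))
    (k : ℕ) (i j : Fin 2) :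
    SmoothOn (regularSet n U lam φ) (fun x t => darbouxCoeff n lam φ k x t i j) := by
  have hH : ∀ a b, SmoothOn (regularSet n U lam φ) (fun x t => (Hmat n lam φ x t)ᵀ a b) :=
    fun a b => (smoothOn_Hmat_entry hφ b a).mono fun z hz => hz.1
  have hw : ∀ a, SmoothOn (regularSet n U lam φ)
      (fun x t => (((Hmat n lam φ x t)ᵀ)⁻¹ *ᵥ colD n lam φ x t i) a) := by
    intro a
    simp only [Matrix.inv_def, Matrix.mulVec, dotProduct, Matrix.smul_apply, Ring.inverse_eq_inv',
      smul_eq_mul, Matrix.adjugate_apply]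
    refine SmoothOn.sum _ fun b _ => SmoothOn.mul (SmoothOn.mul ?_ (SmoothOn.det ?_)) ?_
    · refine ((SmoothOn.const 1).div (SmoothOn.det hH) fun x t h => h.2).congr fun x t _ => ?_
      rw [one_div]
    · intro c d
      by_cases hc : c = b
      · subst hc
        simpa only [Matrix.updateRow_self] using SmoothOn.const _
      · simpa only [Matrix.updateRow_ne hc] using hH c d
    · exact SmoothOn.const_mul _ ((hφ b b.2 i).mono fun z hz => hz.1)
  unfold darbouxCoeff unpack
  simp only [Matrix.of_apply]
  split_ifs with h
  · exact hw _
  · exact SmoothOn.const 0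

end

/-- The PT conjugation `A ↦ J A* J⁻¹` of matrices, with `J = !![0, 1; σ, 0]`. -/
def conjMat (σ : ℂ) (A : Mat2) : Mat2 :=
  !![conj (A 1 1), σ * conj (A 1 0); σ * conj (A 0 1), conj (A 0 0)]

/-- The PT conjugation `v ↦ J v*` of vectors, with `J = !![0, 1; σ, 0]`. -/
def conjVec (σ : ℂ) (v : Fin 2 → ℂ) : Fin 2 → ℂ := ![conj (v 1), σ * conj (v 0)]

section
variable {σ : ℂ}

lemma conjMat_mulVec (hσ : σ ^ 2 = 1) (A : Mat2) (v : Fin 2 → ℂ) :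
    conjMat σ A *ᵥ conjVec σ v = conjVec σ (A *ᵥ v) := by
  funext i
  fin_cases i <;> simp [conjMat, conjVec, Matrix.mulVec, dotProduct, Fin.sum_univ_two]
  · linear_combination (conj (A 1 0) * conj (v 0)) * hσ
  · ring

lemma conjMat_involutive (hσ : σ ^ 2 = 1) (hc : conj σ = σ) (A : Mat2) :
    conjMat σ (conjMat σ A) = A := by
  ext i j
  fin_cases i <;> fin_cases j <;> simp [conjMat, hc]
  · linear_combination A 0 1 * hσ
  · linear_combination A 1 0 * hσ

lemma conjMat_coeffSum (n : ℕ) (C : ℕ → Mat2) (μ : ℂ) :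
    conjMat σ (coeffSum n C μ) = coeffSum n (fun k => conjMat σ (C k)) (conj μ) := by
  ext i j
  fin_cases i <;> fin_cases j <;>
    simp [conjMat, coeffSum_apply, Finset.mul_sum, mul_left_comm σ]

lemma conjMat_monicSum (n : ℕ) (C : ℕ → Mat2) (μ : ℂ) :
    conjMat σ (monicSum n C μ) = monicSum n (fun k => conjMat σ (C k)) (conj μ) := by
  rw [monicSum, monicSum, ← conjMat_coeffSum]
  ext i j
  fin_cases i <;> fin_cases j <;> simp [conjMat]

/-- `v` and `v'` are PT partners: the parameters are permuted by complex conjugation, and the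
vectors correspondingly by `v ↦ J v*`, up to scalar factors. -/
def IsPartner (n : ℕ) (σ : ℂ) (lam : ℕ → ℂ) (v v' : ℕ → Fin 2 → ℂ) : Prop :=
  ∀ k < 2 * n, ∃ l < 2 * n, ∃ c : ℂ, lam k = conj (lam l) ∧ v k = c • conjVec σ (v' l)

variable {n : ℕ} {lam : ℕ → ℂ} {v v' : ℕ → Fin 2 → ℂ}

lemma conjMat_mulVec_eq_zero (hσ : σ ^ 2 = 1) {A : Mat2} {w : Fin 2 → ℂ} (c : ℂ)
    (h : A *ᵥ w = 0) : conjMat σ A *ᵥ (c • conjVec σ w) = 0 := by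
  rw [Matrix.mulVec_smul, conjMat_mulVec hσ, h]
  ext i
  fin_cases i <;> simp [conjVec]

lemma IsPartner.unisolvent (hσ : σ ^ 2 = 1) (hc : conj σ = σ) (hp : IsPartner n σ lam v v')
    (hu : Unisolvent n lam v) : Unisolvent n lam v' := by
  intro C hC m hm
  have h := hu (fun k => conjMat σ (C k)) (fun k hk => ?_) m hm
  · rw [← conjMat_involutive hσ hc (C m), h]
    ext i j
    fin_cases i <;> fin_cases j <;> simp [conjMat]
  · obtain ⟨l, hl, c, hlam, hv⟩ := hp k hk
    rw [hv, hlam, ← conjMat_coeffSum]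
    exact conjMat_mulVec_eq_zero hσ c (hC l hl)

/-- Darboux matrices at PT partners are PT conjugate, by uniqueness of interpolation. -/
lemma IsPartner.eq_conjMat (hσ : σ ^ 2 = 1) (hp : IsPartner n σ lam v v')
    (hu : Unisolvent n lam v) {C C' : ℕ → Mat2}
    (hC : ∀ k < 2 * n, monicSum n C (lam k) *ᵥ v k = 0)
    (hC' : ∀ k < 2 * n, monicSum n C' (lam k) *ᵥ v' k = 0) {m : ℕ} (hm : m < n) :
    C m = conjMat σ (C' m) := by
  refine hu.eq_of_monicSum_mulVec hC (D := fun k => conjMat σ (C' k)) (fun k hk => ?_) hm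
  obtain ⟨l, hl, c, hlam, hv⟩ := hp k hk
  rw [hv, hlam, ← conjMat_monicSum]
  exact conjMat_mulVec_eq_zero hσ c (hC' l hl)

/-- The pairing of the eigenfunctions makes the points `(x, t)` and `(-x, t)` PT partners. -/
lemma isPartner_of_pairing {φ : ℕ → ℝ → ℝ → Fin 2 → ℂ} {ζ : ℕ → ℂ} {U : Set (ℝ × ℝ)}
    (hσ : σ ^ 2 = 1) (hc : conj σ = σ) (hU : IsPTDomain U)
    (hlam : ∀ j < n, lam (2 * j + 1) = conj (lam (2 * j)))
    (hζ : ∀ j < n, ζ j = 1 ∨ ζ j = -1)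
    (hpair : ∀ j < n, ∀ x t : ℝ, (x, t) ∈ U →
      φ (2 * j + 1) x t 0 = ζ j * conj (φ (2 * j) (-x) t 1) ∧
      φ (2 * j + 1) x t 1 = σ * ζ j * conj (φ (2 * j) (-x) t 0))
    {x t : ℝ} (h : (x, t) ∈ U) :
    IsPartner n σ lam (fun k => φ k x t) (fun k => φ k (-x) t) := by
  intro k hk
  obtain ⟨j, rfl | rfl⟩ : ∃ j, k = 2 * j ∨ k = 2 * j + 1 := ⟨k / 2, by omega⟩
  all_goals
    have hj : j < n := by omega
    have hζ2 : ζ j * ζ j = 1 := by rcases hζ j hj with h | h <;> simp [h]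
    have hζc : conj (ζ j) = ζ j := by rcases hζ j hj with h | h <;> simp [h]
  · obtain ⟨h0, h1⟩ := hpair j hj (-x) t (hU.symm x t h)
    rw [neg_neg] at h0 h1
    refine ⟨2 * j + 1, by omega, σ * ζ j, by rw [hlam j hj]; simp, ?_⟩
    funext i
    fin_cases i <;> simp [conjVec, h0, h1, hζc, hc]
    · linear_combination (-φ (2 * j) x t 0) * (ζ j * ζ j) * hσ - φ (2 * j) x t 0 * hζ2
    · linear_combination (-φ (2 * j) x t 1) * (ζ j * ζ j) * hσ - φ (2 * j) x t 1 * hζ2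
  · obtain ⟨h0, h1⟩ := hpair j hj x t h
    refine ⟨2 * j, by omega, ζ j, hlam j hj, ?_⟩
    funext i
    fin_cases i <;> simp [conjVec, h0, h1]
    ring

end

/-! ### The Darboux matrix as a gauge transformation -/

/-- Derivative of the relation `T(μ) v = 0` for a monic matrix polynomial `T`. -/
lemma monicSum_mulVec_deriv {n : ℕ} {μ : ℂ} {I : Set ℝ} (hI : IsOpen I) {C : ℕ → ℝ → Mat2}
    {D : ℕ → Mat2} {v : ℝ → Fin 2 → ℂ} {v' : Fin 2 → ℂ} {s : ℝ} (hs : s ∈ I)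
    (hC : ∀ k, HasMatDeriv (C k) (D k) s) (hv : HasDerivAt v v' s)
    (h : ∀ u ∈ I, monicSum n (fun k => C k u) μ *ᵥ v u = 0) :
    -(coeffSum n D μ) *ᵥ v s + monicSum n (fun k => C k s) μ *ᵥ v' = 0 := by
  refine ((HasMatDeriv.monicSum hC n μ).mulVec hv).unique
    ((hasDerivAt_const s (0 : Fin 2 → ℂ)).congr_of_eventuallyEq ?_)
  filter_upwards [hI.mem_nhds hs] with u hu using h u hu

lemma HasMatDeriv.congr_of_eqOn {I : Set ℝ} (hI : IsOpen I) {A B : ℝ → Mat2} {A' : Mat2} {s : ℝ}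
    (hs : s ∈ I) (h : ∀ u ∈ I, A u = B u) (hB : HasMatDeriv B A' s) : HasMatDeriv A A' s := by
  intro i j
  refine (hB i j).congr_of_eventuallyEq ?_
  filter_upwards [hI.mem_nhds hs] with u hu
  rw [h u hu]

lemma hasMatDeriv_offMat {q r : ℝ → ℂ} {q' r' : ℂ} {s : ℝ} (hq : HasDerivAt q q' s)
    (hr : HasDerivAt r r' s) : HasMatDeriv (fun u => offMat (q u) (r u)) (offMat q' r') s := by
  intro i j
  fin_cases i <;> fin_cases j
  · exact hasDerivAt_const s (0 : ℂ)
  · exact hq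
  · exact hr
  · exact hasDerivAt_const s (0 : ℂ)

lemma evolRHS_aknsCoeff (U V : Mat2) (C : ℕ → Mat2) (k : ℕ) :
    evolRHS (aknsCoeff U) (aknsCoeff V) C 0 k = timeRHS U V (C k) (shift C k) := by
  simp [evolRHS, aknsCoeff, timeRHS]

lemma shift_timeRHS {n : ℕ} {U V : Mat2} {C D : ℕ → Mat2}
    (h : ∀ m < n, D m = timeRHS U V (C m) (shift C m)) {m : ℕ} (hm : m < n) :
    shift D m = timeRHS U V (shift C m) (shift (shift C) m) := by
  cases m with
  | zero => simp [shift, timeRHS]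
  | succ m => exact h m (by omega)

lemma isOpen_timeLine {V : Set (ℝ × ℝ)} (hV : IsOpen V) (x : ℝ) : IsOpen {s : ℝ | (x, s) ∈ V} :=
  hV.preimage (by fun_prop : Continuous fun s : ℝ => (x, s))

lemma isOpen_spaceLine {V : Set (ℝ × ℝ)} (hV : IsOpen V) (t : ℝ) : IsOpen {y : ℝ | (y, t) ∈ V} :=
  hV.preimage (by fun_prop : Continuous fun y : ℝ => (y, t))

/-- What the construction of the Darboux matrix `T` provides on the set `V`: a solution with
eigenfunctions `φ k`, and smooth PT symmetric coefficients `S k` of a monic matrix polynomial `T`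
which kills the eigenfunctions and is determined by that. -/
structure DarbouxData (σ : ℂ) (ε₁ ε₂ ω : ℝ) (n : ℕ) (V : Set (ℝ × ℝ)) (E p η : ℝ → ℝ → ℂ)
    (lam : ℕ → ℂ) (φ : ℕ → ℝ → ℝ → Fin 2 → ℂ) (S : ℕ → ℝ → ℝ → Mat2)
    (T : ℂ → ℝ → ℝ → Mat2) : Prop where
  sq_eq : σ ^ 2 = 1
  conj_eq : conj σ = σ
  pos : 0 < n
  sol : IsSolutionOn σ ε₁ ε₂ ω V E p η
  lam_ne : ∀ k < 2 * n, lam k + (ω : ℂ) ≠ 0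
  eigen : ∀ k < 2 * n, IsEigenfunctionOn σ ε₁ ε₂ ω V E p η (lam k) (φ k)
  smooth : ∀ k i j, SmoothOn V (fun x t => S k x t i j)
  uni : ∀ x t, (x, t) ∈ V → Unisolvent n lam (fun k => φ k x t)
  kill : ∀ x t, (x, t) ∈ V → ∀ k < 2 * n,
    monicSum n (fun m => S m x t) (lam k) *ᵥ φ k x t = 0
  symm : ∀ x t, (x, t) ∈ V → ∀ m < n, S m x t = conjMat σ (S m (-x) t)
  eq_T : ∀ x t, (x, t) ∈ V → ∀ μ, T μ x t = monicSum n (fun m => S m x t) μ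

namespace DarbouxData

variable {σ : ℂ} {ε₁ ε₂ ω : ℝ} {n : ℕ} {V : Set (ℝ × ℝ)} {E p η : ℝ → ℝ → ℂ}
  {lam : ℕ → ℂ} {φ : ℕ → ℝ → ℝ → Fin 2 → ℂ} {S : ℕ → ℝ → ℝ → Mat2} {T : ℂ → ℝ → ℝ → Mat2}

lemma det_ne_zero (d : DarbouxData σ ε₁ ε₂ ω n V E p η lam φ S T) {x t : ℝ} (h : (x, t) ∈ V) :
    (T (-ω) x t).det ≠ 0 := by
  rw [d.eq_T x t h]
  refine (d.uni x t h).det_monicSum_ne_zero d.pos (d.kill x t h) fun k hk he => ?_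
  exact d.lam_ne k hk (by rw [he]; ring)

lemma smooth_T (d : DarbouxData σ ε₁ ε₂ ω n V E p η lam φ S T) (μ : ℂ) (i j : Fin 2) :
    SmoothOn V (fun x t => T μ x t i j) := by
  have h : SmoothOn V (fun x t => (μ ^ n • (1 : Mat2)) i j
      - ∑ k ∈ Finset.range n, μ ^ k * S k x t i j) :=
    (SmoothOn.const _).sub (SmoothOn.sum _ fun k _ => (d.smooth k i j).const_mul _)
  refine h.congr fun x t hx => ?_
  rw [d.eq_T x t hx, monicSum, Matrix.sub_apply, coeffSum_apply]

lemma T_symm (d : DarbouxData σ ε₁ ε₂ ω n V E p η lam φ S T) {x t : ℝ} (h : (x, t) ∈ V) :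
    T (-ω) x t = conjMat σ (T (-ω) (-x) t) := by
  rw [d.eq_T x t h, d.eq_T (-x) t (d.sol.domain.symm x t h), conjMat_monicSum, monicSum, monicSum,
    coeffSum_congr (d.symm x t h)]
  simp

lemma smooth_newE (d : DarbouxData σ ε₁ ε₂ ω n V E p η lam φ S T) :
    SmoothOn V (newE (S (n - 1)) E) :=
  d.sol.smooth_E.sub ((d.smooth (n - 1) 0 1).const_mul (2 * Complex.I))

lemma denom_ne_zero (d : DarbouxData σ ε₁ ε₂ ω n V E p η lam φ S T) {x t : ℝ} (h : (x, t) ∈ V) :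
    T (-ω) x t 0 0 * T (-ω) x t 1 1 - T (-ω) x t 0 1 * T (-ω) x t 1 0 ≠ 0 := by
  have := d.det_ne_zero h
  rwa [Matrix.det_fin_two] at this

lemma smooth_newP (d : DarbouxData σ ε₁ ε₂ ω n V E p η lam φ S T) :
    SmoothOn V (newP σ (T (-ω)) p η) := by
  have hT := d.smooth_T (-ω)
  have hp := d.sol.smooth_p
  have hη := d.sol.smooth_η
  exact SmoothOn.div (((hp.mul ((hT 0 0).pow 2)).sub
    (((hp.conj_neg d.sol.domain).const_mul σ).mul ((hT 0 1).pow 2))).add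
    (((hη.const_mul (2 * σ)).mul (hT 0 0)).mul (hT 0 1)))
    (((hT 0 0).mul (hT 1 1)).sub ((hT 0 1).mul (hT 1 0))) fun x t h => d.denom_ne_zero h

lemma smooth_newη (d : DarbouxData σ ε₁ ε₂ ω n V E p η lam φ S T) :
    SmoothOn V (newη σ (T (-ω)) p η) := by
  have hT := d.smooth_T (-ω)
  have hp := d.sol.smooth_p
  have hη := d.sol.smooth_η
  exact SmoothOn.div (((((hp.const_mul σ).mul (hT 0 0)).mul (hT 1 0)).sub
    (((hp.conj_neg d.sol.domain).mul (hT 0 1)).mul (hT 1 1))).add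
    (hη.mul (((hT 0 0).mul (hT 1 1)).add ((hT 0 1).mul (hT 1 0)))))
    (((hT 0 0).mul (hT 1 1)).sub ((hT 0 1).mul (hT 1 0))) fun x t h => d.denom_ne_zero h

/-- The PT symmetry of the top coefficient makes its entry `(1, 0)`, which determines the new `r`,
compatible with the entry `(0, 1)`, which determines the new `q = E`. -/
lemma newE_rel (d : DarbouxData σ ε₁ ε₂ ω n V E p η lam φ S T) {x t : ℝ} (h : (x, t) ∈ V) :
    offMat (newE (S (n - 1)) E x t) (σ * pt (newE (S (n - 1)) E) x t)
      - offMat (E x t) (σ * pt E x t) = sigmaK * S (n - 1) x t - S (n - 1) x t * sigmaK := by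
  rw [offMat_sub_eq_commSigma_iff]
  have h10 : S (n - 1) x t 1 0 = σ * conj (S (n - 1) (-x) t 0 1) := by
    rw [d.symm x t h (n - 1) (by have := d.pos; omega)]; rfl
  refine ⟨by simp only [newE]; ring, ?_⟩
  rw [h10]
  simp only [newE, pt, map_sub, map_mul, Complex.conj_I, map_ofNat]
  ring

lemma hasMatDeriv_t (d : DarbouxData σ ε₁ ε₂ ω n V E p η lam φ S T) {x t : ℝ} (h : (x, t) ∈ V)
    (k : ℕ) : HasMatDeriv (fun s => S k x s)
      (Matrix.of fun i j => dt (fun x t => S k x t i j) x t) t :=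
  fun i j => (d.smooth k i j).hasDerivAt_dt d.sol.domain.isOpen h

lemma hasMatDeriv_x (d : DarbouxData σ ε₁ ε₂ ω n V E p η lam φ S T) {x t : ℝ} (h : (x, t) ∈ V)
    (k : ℕ) : HasMatDeriv (fun y => S k y t)
      (Matrix.of fun i j => dx (fun x t => S k x t i j) x t) x :=
  fun i j => (d.smooth k i j).hasDerivAt_dx d.sol.domain.isOpen h

/-- The time part of the Darboux transformation, and the evolution of the coefficients. -/
lemma evolution_t (d : DarbouxData σ ε₁ ε₂ ω n V E p η lam φ S T) {x t : ℝ} (h : (x, t) ∈ V) :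
    (∀ m < n, (Matrix.of fun i j => dt (fun x t => S m x t i j) x t)
      = timeRHS (offMat (E x t) (σ * pt E x t))
        (offMat (newE (S (n - 1)) E x t) (σ * pt (newE (S (n - 1)) E) x t))
        (S m x t) (shift (fun k => S k x t) m)) ∧
    ∀ μ, HasMatDeriv (fun s => T μ x s)
      (ptM σ (newE (S (n - 1)) E) μ x t * T μ x t - T μ x t * ptM σ E μ x t) t := by
  have hI := isOpen_timeLine d.sol.domain.isOpen x
  have hev := (d.uni x t h).evolution d.pos (C := fun k => S k x t)
    (D := fun k => Matrix.of fun i j => dt (fun x t => S k x t i j) x t)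
    (Z := 0) (P := 0) (P' := 0) (s := fun _ => 0) (good := fun _ => True)
    (TopMatch.akns (d.newE_rel h)) (fun μ _ => by simp [coeffSum]) (fun _ _ => trivial)
    (d.kill x t h) (fun k hk => by
      rw [← laxM_eq_cubic E (fun x t => σ * pt E x t)]
      exact monicSum_mulVec_deriv hI h (d.hasMatDeriv_t h) ((d.eigen k hk).eq_t x t h)
        fun u hu => d.kill x u hu k hk)
  refine ⟨fun m hm => (hev.1 m hm).trans (evolRHS_aknsCoeff _ _ _ _), fun μ => ?_⟩
  have hT := HasMatDeriv.congr_of_eqOn hI (A := fun s => T μ x s) h (fun u hu => d.eq_T x u hu μ)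
    (HasMatDeriv.monicSum (d.hasMatDeriv_t h) n μ)
  rw [hev.2 μ trivial, ← d.eq_T x t h] at hT
  simpa only [ptM, laxM_eq_cubic] using hT

/-- The jet relations between the old and the new potentials. -/
lemma jetRel (d : DarbouxData σ ε₁ ε₂ ω n V E p η lam φ S T) {x t : ℝ} (h : (x, t) ∈ V)
    {E' r r' : ℝ → ℝ → ℂ} (hE' : E' = newE (S (n - 1)) E) (hr : r = fun x t => σ * pt E x t)
    (hr' : r' = fun x t => σ * pt E' x t) :
    JetRel (offMat (E x t) (r x t)) (offMat (dt E x t) (dt r x t))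
      (offMat (dt (dt E) x t) (dt (dt r) x t)) (offMat (dt (dt (dt E)) x t) (dt (dt (dt r)) x t))
      (offMat (E' x t) (r' x t)) (offMat (dt E' x t) (dt r' x t))
      (offMat (dt (dt E') x t) (dt (dt r') x t))
      (offMat (dt (dt (dt E')) x t) (dt (dt (dt r')) x t))
      (S (n - 1) x t) (shift (fun k => S k x t) (n - 1)) (shift (shift fun k => S k x t) (n - 1))
      (shift (shift (shift fun k => S k x t)) (n - 1)) := by
  have hV := d.sol.domain.isOpen
  have hlt : n - 1 < n := by have := d.pos; omega
  have sE : SmoothOn V E := d.sol.smooth_E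
  have sE' : SmoothOn V E' := hE' ▸ d.smooth_newE
  have sr : SmoothOn V r := hr ▸ (sE.conj_neg d.sol.domain).const_mul σ
  have sr' : SmoothOn V r' := hr' ▸ (sE'.conj_neg d.sol.domain).const_mul σ
  have hev : ∀ s ∈ {s : ℝ | (x, s) ∈ V}, ∀ m < n,
      (Matrix.of fun i j => dt (fun x t => S m x t i j) x s)
        = timeRHS (offMat (E x s) (r x s)) (offMat (E' x s) (r' x s))
          (S m x s) (shift (fun k => S k x s) m) := fun s hs m hm => by
    subst hr' hr hE'
    exact (d.evolution_t hs).1 m hm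
  have off : ∀ {f g : ℝ → ℝ → ℂ}, SmoothOn V f → SmoothOn V g → ∀ s ∈ {s : ℝ | (x, s) ∈ V},
      HasMatDeriv (fun s => offMat (f x s) (g x s)) (offMat (dt f x s) (dt g x s)) s :=
    fun hf hg s hs => hasMatDeriv_offMat (hf.hasDerivAt_dt hV hs) (hg.hasDerivAt_dt hV hs)
  refine jetRel_of_hasMatDeriv (isOpen_timeLine hV x) (s := t)
    (U := fun s => offMat (E x s) (r x s)) (U₁ := fun s => offMat (dt E x s) (dt r x s))
    (U₂ := fun s => offMat (dt (dt E) x s) (dt (dt r) x s))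
    (U₃ := fun s => offMat (dt (dt (dt E)) x s) (dt (dt (dt r)) x s))
    (V := fun s => offMat (E' x s) (r' x s)) (V₁ := fun s => offMat (dt E' x s) (dt r' x s))
    (V₂ := fun s => offMat (dt (dt E') x s) (dt (dt r') x s))
    (V₃ := fun s => offMat (dt (dt (dt E')) x s) (dt (dt (dt r')) x s))
    (S₁ := fun s => S (n - 1) x s) (S₂ := fun s => shift (fun k => S k x s) (n - 1))
    (S₃ := fun s => shift (shift fun k => S k x s) (n - 1))
    (S₄ := fun s => shift (shift (shift fun k => S k x s)) (n - 1))
    (off sE sr) (off (sE.dt hV) (sr.dt hV)) (off ((sE.dt hV).dt hV) ((sr.dt hV).dt hV))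
    (off sE' sr') (off (sE'.dt hV) (sr'.dt hV)) (off ((sE'.dt hV).dt hV) ((sr'.dt hV).dt hV))
    (fun s hs => ?_) (fun s hs => ?_) (fun s hs => ?_) (fun s hs => ?_) h
  · rw [← hev s hs _ hlt]
    exact d.hasMatDeriv_t hs _
  · rw [← shift_timeRHS (hev s hs) hlt]
    exact HasMatDeriv.shift (d.hasMatDeriv_t hs) _
  · rw [← shift_timeRHS (fun m hm => shift_timeRHS (hev s hs) hm) hlt]
    exact HasMatDeriv.shift (HasMatDeriv.shift (d.hasMatDeriv_t hs)) _
  · subst hr' hr hE'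
    exact d.newE_rel hs

/-- The residue of the new Lax matrix is the conjugate of the old one by `T(-ω)`. This is how the
formulas for the new `p` and `η` arise. -/
lemma poleMat_mul (d : DarbouxData σ ε₁ ε₂ ω n V E p η lam φ S T) {x t : ℝ} (h : (x, t) ∈ V) :
    poleMat σ (newP σ (T (-ω)) p η x t) (σ * pt (newP σ (T (-ω)) p η) x t)
        (newη σ (T (-ω)) p η x t) * T (-ω) x t
      = T (-ω) x t * poleMat σ (p x t) (σ * pt p x t) (η x t) := by
  have hΔ := d.denom_ne_zero h
  have hs := d.T_symm (d.sol.domain.symm x t h)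
  have hσ := d.sq_eq
  have hc := d.conj_eq
  have hη : conj (η (-x) t) = -η x t := by
    have := d.sol.symm_η x t h
    rw [this]; simp [pt]
  rw [neg_neg] at hs
  have h00 : conj (T (-ω) (-x) t 0 0) = T (-ω) x t 1 1 := by rw [hs]; simp [conjMat]
  have h11 : conj (T (-ω) (-x) t 1 1) = T (-ω) x t 0 0 := by rw [hs]; simp [conjMat]
  have h01 : conj (T (-ω) (-x) t 0 1) = σ * T (-ω) x t 1 0 := by rw [hs]; simp [conjMat, hc]
  have h10 : conj (T (-ω) (-x) t 1 0) = σ * T (-ω) x t 0 1 := by rw [hs]; simp [conjMat, hc]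
  have hpt : σ * pt (newP σ (T (-ω)) p η) x t
      = (σ * pt p x t * (T (-ω) x t 1 1) ^ 2 - p x t * (T (-ω) x t 1 0) ^ 2
        - 2 * σ * η x t * T (-ω) x t 1 0 * T (-ω) x t 1 1)
      / (T (-ω) x t 0 0 * T (-ω) x t 1 1 - T (-ω) x t 0 1 * T (-ω) x t 1 0) := by
    simp only [newP, pt, map_div₀, map_sub, map_add, map_mul, map_pow, map_ofNat, h00, h11, h01,
      h10, hη, hc, neg_neg, Complex.conj_conj]
    rw [show T (-ω) x t 1 1 * T (-ω) x t 0 0 - σ * T (-ω) x t 1 0 * (σ * T (-ω) x t 0 1)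
      = T (-ω) x t 0 0 * T (-ω) x t 1 1 - T (-ω) x t 0 1 * T (-ω) x t 1 0 by
        linear_combination (-T (-ω) x t 1 0 * T (-ω) x t 0 1) * hσ]
    rw [mul_div_assoc']
    congr 1
    linear_combination (-p x t * (T (-ω) x t 1 0) ^ 2 * (σ ^ 2 + 1)
      - 2 * σ * η x t * T (-ω) x t 1 0 * T (-ω) x t 1 1) * hσ
  rw [hpt, newP, newη]
  generalize T (-ω) x t = A at hΔ
  rw [mat2_ext_iff]
  simp only [mat2_mul_apply, poleMat, Matrix.of_apply, Matrix.cons_val', Matrix.cons_val_zero,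
    Matrix.cons_val_one, Matrix.cons_val_fin_one]
  refine ⟨⟨?_, ?_⟩, ?_, ?_⟩
  all_goals
    generalize A 0 0 = a at hΔ ⊢
    generalize A 0 1 = b at hΔ ⊢
    generalize A 1 0 = c at hΔ ⊢
    generalize A 1 1 = e at hΔ ⊢
    generalize p x t = P
    generalize pt p x t = P'
    generalize η x t = H
    have hD : (a * e - b * c)⁻¹ * (a * e - b * c) = 1 := inv_mul_cancel₀ hΔ
    simp only [div_eq_mul_inv]
    generalize (a * e - b * c)⁻¹ = D at hD ⊢
    clear hpt hs h00 h11 h01 h10 hη hc hΔ h d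
    grind

end DarbouxData

/-! ### Evolution in `x` and the transformed system -/

namespace DarbouxData

variable {σ : ℂ} {ε₁ ε₂ ω : ℝ} {n : ℕ} {V : Set (ℝ × ℝ)} {E p η : ℝ → ℝ → ℂ}
  {lam : ℕ → ℂ} {φ : ℕ → ℝ → ℝ → Fin 2 → ℂ} {S : ℕ → ℝ → ℝ → Mat2} {T : ℂ → ℝ → ℝ → Mat2}

/-- The space part of the Darboux transformation, and the evolution of the coefficients. The pole
contributes the quotient of `T P - P' T`, which vanishes at `-ω`, by `μ + ω`. -/
lemma evolution_x (d : DarbouxData σ ε₁ ε₂ ω n V E p η lam φ S T) {x t : ℝ} (h : (x, t) ∈ V)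
    {E' p' η' r r' : ℝ → ℝ → ℂ} (hE' : E' = newE (S (n - 1)) E) (hp' : p' = newP σ (T (-ω)) p η)
    (hη' : η' = newη σ (T (-ω)) p η) (hr : r = fun x t => σ * pt E x t)
    (hr' : r' = fun x t => σ * pt E' x t) {N N' : Fin 4 → Mat2}
    (hN : N = laxCoeff (Complex.I * ε₁) (Complex.I * ε₂) (E x t) (dt E x t) (dt (dt E) x t)
      (r x t) (dt r x t) (dt (dt r) x t))
    (hN' : N' = laxCoeff (Complex.I * ε₁) (Complex.I * ε₂) (E' x t) (dt E' x t) (dt (dt E') x t)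
      (r' x t) (dt r' x t) (dt (dt r') x t)) :
    (∃ Z : ℕ → Mat2, Z (n - 1) = Complex.I • (poleMat σ (p x t) (σ * pt p x t) (η x t)
          - poleMat σ (p' x t) (σ * pt p' x t) (η' x t)) ∧
      ∀ m < n, (Matrix.of fun i j => dx (fun x t => S m x t i j) x t)
        = evolRHS N N' (fun k => S k x t) Z m) ∧
    ∀ μ : ℂ, μ + ω ≠ 0 → HasMatDeriv (fun y => T μ y t)
      (ptN σ ε₁ ε₂ ω E' p' η' μ x t * T μ x t - T μ x t * ptN σ ε₁ ε₂ ω E p η μ x t) x := by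
  have hI := isOpen_spaceLine d.sol.domain.isOpen t
  set P := poleMat σ (p x t) (σ * pt p x t) (η x t) with hP
  set P' := poleMat σ (p' x t) (σ * pt p' x t) (η' x t) with hP'
  have hPT : P' * T (-ω) x t = T (-ω) x t * P := by
    subst hp' hη'; exact d.poleMat_mul h
  have hW : ∀ μ, T μ x t * P - P' * T μ x t
      = μ ^ n • (P - P') + coeffSum n (fun k => P' * S k x t - S k x t * P) μ := by
    intro μ
    rw [d.eq_T x t h, monicSum, coeffSum_sub, coeffSum_mul_left, coeffSum_mul_right]
    simp only [sub_mul, mul_sub, smul_mul_assoc, mul_smul_comm, one_mul, mul_one]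
    module
  obtain ⟨Z, hZ, hZn⟩ := exists_coeffSum_quotient n (P - P')
    (fun k => P' * S k x t - S k x t * P) (-ω) (by rw [← hW, hPT, sub_self])
  have htop := (d.jetRel h hE' hr hr').topMatch (Complex.I * ε₁) (Complex.I * ε₂)
  rw [← hN, ← hN'] at htop
  have hNeq : ∀ μ, ptN σ ε₁ ε₂ ω E p η μ x t = cubic N (Complex.I / (μ + ω)) P μ := by
    intro μ; rw [hN, hr]; rfl
  have hNeq' : ∀ μ, ptN σ ε₁ ε₂ ω E' p' η' μ x t = cubic N' (Complex.I / (μ + ω)) P' μ := by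
    intro μ; rw [hN', hr']; rfl
  have hev := (d.uni x t h).evolution d.pos (C := fun k => S k x t)
    (D := fun k => Matrix.of fun i j => dx (fun x t => S k x t i j) x t)
    (Z := fun k => Complex.I • Z k) (P := P) (P' := P') (s := fun μ => Complex.I / (μ + ω))
    (good := fun μ => μ + ω ≠ 0) htop
    (fun μ hμ => by
      rw [← d.eq_T x t h, hW, hZ, coeffSum_smul, smul_smul, sub_neg_eq_add,
        div_mul_cancel₀ _ hμ])
    d.lam_ne (d.kill x t h) (fun k hk => by
      rw [← hNeq]
      exact monicSum_mulVec_deriv (C := fun k y => S k y t) (v := fun y => φ k y t) hI h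
        (d.hasMatDeriv_x h) ((d.eigen k hk).eq_x x t h)
        fun u hu => d.kill u t hu k hk)
  refine ⟨⟨_, by rw [hZn d.pos], hev.1⟩, fun μ hμ => ?_⟩
  have hT := HasMatDeriv.congr_of_eqOn hI (A := fun y => T μ y t) h (fun u hu => d.eq_T u t hu μ)
    (HasMatDeriv.monicSum (d.hasMatDeriv_x h) n μ)
  rw [hev.2 μ hμ, ← d.eq_T x t h] at hT
  rwa [hNeq, hNeq']

lemma newE_equation (d : DarbouxData σ ε₁ ε₂ ω n V E p η lam φ S T) {x t : ℝ} (h : (x, t) ∈ V)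
    {E' p' : ℝ → ℝ → ℂ} (hE' : E' = newE (S (n - 1)) E) (hp' : p' = newP σ (T (-ω)) p η) :
    dx E' x t =
      (Complex.I * ε₂) * (dt (dt (dt E')) x t - 6 * σ * E' x t * pt E' x t * dt E' x t)
      + Complex.I / 2 * (Complex.I * ε₁)
        * (dt (dt E') x t - 2 * σ * (E' x t) ^ 2 * pt E' x t)
      + 2 * σ * p' x t := by
  obtain ⟨⟨Z, hZ, hD⟩, -⟩ := d.evolution_x h hE' hp' rfl rfl rfl rfl rfl
  have hD' := hD (n - 1) (by have := d.pos; omega)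
  rw [evolRHS, hZ] at hD'
  have hdx : dx E' x t = dx E x t - 2 * Complex.I
      * (Matrix.of fun i j => dx (fun x t => S (n - 1) x t i j) x t) 0 1 := by
    subst hE'
    exact (((d.sol.smooth_E.hasDerivAt_dx d.sol.domain.isOpen h).sub
      ((d.hasMatDeriv_x h (n - 1) 0 1).const_mul (2 * Complex.I)))).deriv
  rw [hdx, (d.jetRel h hE' rfl rfl).evolution_identity hD' (by rw [d.sol.eq_E x t h]; ring)]
  ring

/-- The equations for `p` and `η` say that the residue matrix of `N` evolves by commutation with
`M` at the position of the pole. -/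
lemma hasMatDeriv_poleMat (hσ : σ ^ 2 = 1) (hc : conj σ = σ)
    (hsol : IsSolutionOn σ ε₁ ε₂ ω V E p η) {x t : ℝ} (h : (x, t) ∈ V) :
    HasMatDeriv (fun s => poleMat σ (p x s) (σ * pt p x s) (η x s))
      (ptM σ E (-ω) x t * poleMat σ (p x t) (σ * pt p x t) (η x t)
        - poleMat σ (p x t) (σ * pt p x t) (η x t) * ptM σ E (-ω) x t) t := by
  have hV := hsol.domain.isOpen
  have hp := hsol.smooth_p.hasDerivAt_dt hV h
  have hη := hsol.smooth_η.hasDerivAt_dt hV h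
  have hpt : HasDerivAt (fun s => pt p x s) (conj (dt p (-x) t)) t :=
    (hsol.smooth_p.hasDerivAt_dt hV (hsol.domain.symm x t h)).star
  rw [hsol.eq_p x t h] at hp
  rw [hsol.eq_η x t h] at hη
  rw [hsol.eq_p (-x) t (hsol.domain.symm x t h)] at hpt
  have hηc : conj (η (-x) t) = -η x t := by
    rw [hsol.symm_η x t h]; simp [pt]
  have hEc : conj (E (-x) t) = pt E x t := rfl
  have hpc : conj (p (-x) t) = pt p x t := rfl
  simp only [map_add, map_mul, hηc, hEc, hpc, hc, Complex.conj_I, Complex.conj_ofReal,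
    map_ofNat] at hpt
  intro i j
  fin_cases i <;> fin_cases j
  · refine hη.congr_deriv ?_
    simp [poleMat, ptM, laxM]
    linear_combination (E x t * pt p x t - pt E x t * p x t) * hσ
  · refine (hp.const_mul (-σ)).congr_deriv ?_
    simp [poleMat, ptM, laxM]
    linear_combination (-2 * E x t * η x t) * hσ
  · refine ((hpt.const_mul σ).const_mul (-σ)).congr_deriv ?_
    simp [poleMat, ptM, laxM]
    linear_combination (2 * σ * pt E x t * η x t) * hσ
  · refine hη.neg.congr_deriv ?_
    simp [poleMat, ptM, laxM]
    linear_combination (-E x t * pt p x t + pt E x t * p x t) * hσ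

lemma hasMatDeriv_newPoleMat (d : DarbouxData σ ε₁ ε₂ ω n V E p η lam φ S T) {x t : ℝ}
    (h : (x, t) ∈ V) {E' p' η' : ℝ → ℝ → ℂ} (hE' : E' = newE (S (n - 1)) E)
    (hp' : p' = newP σ (T (-ω)) p η) (hη' : η' = newη σ (T (-ω)) p η) :
    HasMatDeriv (fun s => poleMat σ (p' x s) (σ * pt p' x s) (η' x s))
      (ptM σ E' (-ω) x t * poleMat σ (p' x t) (σ * pt p' x t) (η' x t)
        - poleMat σ (p' x t) (σ * pt p' x t) (η' x t) * ptM σ E' (-ω) x t) t := by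
  have hV := d.sol.domain.isOpen
  have sp : SmoothOn V p' := hp' ▸ d.smooth_newP
  have sη : SmoothOn V η' := hη' ▸ d.smooth_newη
  have hp := sp.hasDerivAt_dt hV h
  have hη := sη.hasDerivAt_dt hV h
  have hpt := (sp.conj_neg d.sol.domain).hasDerivAt_dt hV h
  have hPd : HasMatDeriv (fun s => poleMat σ (p' x s) (σ * pt p' x s) (η' x s))
      (poleMat σ (dt p' x t) (σ * dt (pt p') x t) (dt η' x t)) t := by
    intro i j
    fin_cases i <;> fin_cases j
    · exact hη
    · exact hp.const_mul (-σ)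
    · exact (hpt.const_mul σ).const_mul (-σ)
    · exact hη.neg
  have hrel : ∀ s ∈ {s : ℝ | (x, s) ∈ V}, poleMat σ (p' x s) (σ * pt p' x s) (η' x s)
      * T (-ω) x s = T (-ω) x s * poleMat σ (p x s) (σ * pt p x s) (η x s) := fun s hs => by
    subst hp' hη'; exact d.poleMat_mul hs
  have hT := (d.evolution_t h).2 (-ω)
  rw [← hE'] at hT
  have key := HasMatDeriv.eq_of_eqOn (isOpen_timeLine hV x) h hrel (hPd.mul hT)
    (hT.mul (hasMatDeriv_poleMat d.sq_eq d.conj_eq d.sol h))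
  have h0 := hrel t h
  set P' := poleMat σ (p' x t) (σ * pt p' x t) (η' x t)
  set P := poleMat σ (p x t) (σ * pt p x t) (η x t)
  set D := poleMat σ (dt p' x t) (σ * dt (pt p') x t) (dt η' x t)
  set M := ptM σ E (-ω) x t
  set M' := ptM σ E' (-ω) x t
  have hdet := d.det_ne_zero h
  generalize T (-ω) x t = A at h0 key hdet
  have hDA : D * A = (M' * P' - P' * M') * A := by
    -- `P' A = A P` removes the old residue and the old `M`.
    have e1 : D * A = (M' * A - A * M) * P + A * (M * P - P * M) - P' * (M' * A - A * M) :=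
      eq_sub_of_add_eq key
    have e2 : (M' * A - A * M) * P + A * (M * P - P * M) - P' * (M' * A - A * M)
        = M' * (A * P) - (A * P) * M - P' * M' * A + (P' * A) * M := by noncomm_ring
    rw [e1, e2, ← h0]; noncomm_ring
  have hD : D = M' * P' - P' * M' := by
    have h2 := congrArg (· * A⁻¹) hDA
    simpa only [Matrix.mul_assoc, Matrix.mul_nonsing_inv A (isUnit_iff_ne_zero.2 hdet),
      Matrix.mul_one] using h2
  rwa [← hD]

lemma newη_symm (d : DarbouxData σ ε₁ ε₂ ω n V E p η lam φ S T) {x t : ℝ} (h : (x, t) ∈ V) :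
    newη σ (T (-ω)) p η x t = -pt (newη σ (T (-ω)) p η) x t := by
  have hs := d.T_symm (d.sol.domain.symm x t h)
  have hσ := d.sq_eq
  have hc := d.conj_eq
  have hη : conj (η (-x) t) = -η x t := by
    rw [d.sol.symm_η x t h]; simp [pt]
  rw [neg_neg] at hs
  have h00 : conj (T (-ω) (-x) t 0 0) = T (-ω) x t 1 1 := by rw [hs]; simp [conjMat]
  have h11 : conj (T (-ω) (-x) t 1 1) = T (-ω) x t 0 0 := by rw [hs]; simp [conjMat]
  have h01 : conj (T (-ω) (-x) t 0 1) = σ * T (-ω) x t 1 0 := by rw [hs]; simp [conjMat, hc]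
  have h10 : conj (T (-ω) (-x) t 1 0) = σ * T (-ω) x t 0 1 := by rw [hs]; simp [conjMat, hc]
  simp only [newη, pt, map_div₀, map_sub, map_add, map_mul, h00, h11, h01,
      h10, hη, hc, neg_neg, Complex.conj_conj]
  rw [show T (-ω) x t 1 1 * T (-ω) x t 0 0 - σ * T (-ω) x t 1 0 * (σ * T (-ω) x t 0 1)
      = T (-ω) x t 0 0 * T (-ω) x t 1 1 - T (-ω) x t 0 1 * T (-ω) x t 1 0 by
        linear_combination (-T (-ω) x t 1 0 * T (-ω) x t 0 1) * hσ]
  rw [← neg_div]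
  congr 1
  linear_combination (conj (p (-x) t) * T (-ω) x t 0 1 * T (-ω) x t 1 1
    - η x t * T (-ω) x t 1 0 * T (-ω) x t 0 1) * hσ

/-- The transformed functions solve the same system. -/
lemma isSolutionOn_new (d : DarbouxData σ ε₁ ε₂ ω n V E p η lam φ S T) :
    IsSolutionOn σ ε₁ ε₂ ω V (newE (S (n - 1)) E) (newP σ (T (-ω)) p η)
      (newη σ (T (-ω)) p η) where
  domain := d.sol.domain
  smooth_E := d.smooth_newE
  smooth_p := d.smooth_newP
  smooth_η := d.smooth_newη
  eq_E x t h := d.newE_equation h rfl rfl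
  eq_p x t h := by
    have hσ := d.sq_eq
    have h1 := (d.hasMatDeriv_newPoleMat h rfl rfl rfl 0 1).unique
      ((d.smooth_newP.hasDerivAt_dt d.sol.domain.isOpen h).const_mul (-σ))
    simp [poleMat, ptM, laxM] at h1
    linear_combination σ * h1 + (2 * Complex.I * ω * newP σ (T (-ω)) p η x t
      - dt (newP σ (T (-ω)) p η) x t) * hσ
  eq_η x t h := by
    have hσ := d.sq_eq
    have h1 := (d.hasMatDeriv_newPoleMat h rfl rfl rfl 0 0).unique
      (d.smooth_newη.hasDerivAt_dt d.sol.domain.isOpen h)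
    simp [poleMat, ptM, laxM] at h1
    linear_combination -h1 + (newP σ (T (-ω)) p η x t * pt (newE (S (n - 1)) E) x t
      - pt (newP σ (T (-ω)) p η) x t * newE (S (n - 1)) E x t) * hσ
  symm_η x t h := d.newη_symm h

end DarbouxData

/-- The pairing hypotheses give PT symmetric Darboux data on the regular set. -/
lemma darbouxData_darbouxCoeff {σ : ℂ} (hσ : σ = 1 ∨ σ = -1) {ε₁ ε₂ ω : ℝ} {n : ℕ} (hn : 0 < n)
    {U : Set (ℝ × ℝ)} {E p η : ℝ → ℝ → ℂ} (hsol : IsSolutionOn σ ε₁ ε₂ ω U E p η)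
    {lam : ℕ → ℂ} {φ : ℕ → ℝ → ℝ → Fin 2 → ℂ} {ζ : ℕ → ℂ}
    (hω : ∀ k < 2 * n, lam k + (ω : ℂ) ≠ 0)
    (hφ : ∀ k < 2 * n, IsEigenfunctionOn σ ε₁ ε₂ ω U E p η (lam k) (φ k))
    (hlam : ∀ j < n, lam (2 * j + 1) = conj (lam (2 * j)))
    (hζ : ∀ j < n, ζ j = 1 ∨ ζ j = -1)
    (hpair : ∀ j < n, ∀ x t : ℝ, (x, t) ∈ U →
      φ (2 * j + 1) x t 0 = ζ j * conj (φ (2 * j) (-x) t 1) ∧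
      φ (2 * j + 1) x t 1 = σ * ζ j * conj (φ (2 * j) (-x) t 0)) :
    DarbouxData σ ε₁ ε₂ ω n (regularSet n U lam φ) E p η lam φ (darbouxCoeff n lam φ)
      (fun μ => darbouxMatrix n lam φ μ) := by
  have hσ2 : σ ^ 2 = 1 := by rcases hσ with rfl | rfl <;> simp
  have hc : conj σ = σ := by rcases hσ with rfl | rfl <;> simp
  have hsub : regularSet n U lam φ ⊆ U := fun z hz => hz.1
  have hφs : ∀ k < 2 * n, ∀ i, SmoothOn U (fun x t => φ k x t i) := fun k hk i =>
    contDiffOn_pi.1 (hφ k hk).smooth i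
  have hpart : ∀ {x t : ℝ}, (x, t) ∈ U →
      IsPartner n σ lam (fun k => φ k x t) (fun k => φ k (-x) t) := fun h =>
    isPartner_of_pairing hσ2 hc hsol.domain hlam hζ hpair h
  have hdom : IsPTDomain (regularSet n U lam φ) :=
    { isOpen := isOpen_regularSet hsol.domain.isOpen hφs
      symm := fun x t h => ⟨hsol.domain.symm x t h.1,
        (unisolvent_iff_det_ne_zero n lam φ (-x) t).1
          ((hpart h.1).unisolvent hσ2 hc ((unisolvent_iff_det_ne_zero n lam φ x t).2 h.2))⟩ }
  exact
    { sq_eq := hσ2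
      conj_eq := hc
      pos := hn
      sol :=
        { domain := hdom
          smooth_E := hsol.smooth_E.mono hsub
          smooth_p := hsol.smooth_p.mono hsub
          smooth_η := hsol.smooth_η.mono hsub
          eq_E := fun x t h => hsol.eq_E x t h.1
          eq_p := fun x t h => hsol.eq_p x t h.1
          eq_η := fun x t h => hsol.eq_η x t h.1
          symm_η := fun x t h => hsol.symm_η x t h.1 }
      lam_ne := hω
      eigen := fun k hk =>
        { smooth := (hφ k hk).smooth.mono hsub
          eq_t := fun x t h => (hφ k hk).eq_t x t h.1
          eq_x := fun x t h => (hφ k hk).eq_x x t h.1 }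
      smooth := smoothOn_darbouxCoeff hφs
      uni := fun x t h => (unisolvent_iff_det_ne_zero n lam φ x t).2 h.2
      kill := fun x t h k hk => monicSum_darbouxCoeff_mulVec n lam φ x t h.2 hk
      symm := fun x t h m hm => (hpart h.1).eq_conjMat hσ2
        ((unisolvent_iff_det_ne_zero n lam φ x t).2 h.2)
        (fun k hk => monicSum_darbouxCoeff_mulVec n lam φ x t h.2 hk)
        (fun k hk => monicSum_darbouxCoeff_mulVec n lam φ (-x) t (hdom.symm x t h).2 hk) hm
      eq_T := fun x t h μ => darbouxMatrix_eq_monicSum n lam φ x t h.2 μ }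

end NHMB

end

theorem theorem1 (σ : ℂ) (hσ : σ = 1 ∨ σ = -1) (ε₁ ε₂ ω : ℝ) (n : ℕ) (hn : 0 < n)
    (U : Set (ℝ × ℝ)) (E p η : ℝ → ℝ → ℂ)
    (hsol : NHMB.IsSolutionOn σ ε₁ ε₂ ω U E p η)
    (lam : ℕ → ℂ) (φ : ℕ → ℝ → ℝ → Fin 2 → ℂ) (ζ : ℕ → ℂ)
    (hω : ∀ k < 2 * n, lam k + (ω : ℂ) ≠ 0)
    (hφ : ∀ k < 2 * n, NHMB.IsEigenfunctionOn σ ε₁ ε₂ ω U E p η (lam k) (φ k))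
    (hlam : ∀ j < n, lam (2 * j + 1) = conj (lam (2 * j)))
    (hζ : ∀ j < n, ζ j = 1 ∨ ζ j = -1)
    (hpair : ∀ j < n, ∀ x t : ℝ, (x, t) ∈ U →
      φ (2 * j + 1) x t 0 = ζ j * conj (φ (2 * j) (-x) t 1) ∧
      φ (2 * j + 1) x t 1 = σ * ζ j * conj (φ (2 * j) (-x) t 0)) :
    -- the composition of `n` one-fold transformations is the ratio of determinants
    (∀ x t : ℝ, (x, t) ∈ U →
      (∀ m < n,
        (NHMB.pairMat (NHMB.iteratedDarboux lam φ x t m) m lam φ x t).det ≠ 0) →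
      (x, t) ∈ NHMB.regularSet n U lam φ ∧
      ∀ μ : ℂ, NHMB.iteratedDarboux lam φ x t n μ = NHMB.darbouxMatrix n lam φ μ x t) ∧
    -- the ratio of determinants is a Darboux matrix of the stated form
    ∃ S : ℕ → ℝ → ℝ → Matrix (Fin 2) (Fin 2) ℂ,
      (∀ x t : ℝ, (x, t) ∈ NHMB.regularSet n U lam φ → ∀ μ : ℂ,
        NHMB.darbouxMatrix n lam φ μ x t
          = μ ^ n • (1 : Matrix (Fin 2) (Fin 2) ℂ)
            - ∑ k ∈ Finset.range n, μ ^ k • S k x t) ∧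
      (∀ x t : ℝ, (x, t) ∈ NHMB.regularSet n U lam φ →
        (NHMB.darbouxMatrix n lam φ (-ω) x t).det ≠ 0) ∧
      (∀ E' p' η' : ℝ → ℝ → ℂ,
        E' = NHMB.newE (S (n - 1)) E →
        p' = NHMB.newP σ (NHMB.darbouxMatrix n lam φ (-ω)) p η →
        η' = NHMB.newη σ (NHMB.darbouxMatrix n lam φ (-ω)) p η →
        NHMB.IsSolutionOn σ ε₁ ε₂ ω (NHMB.regularSet n U lam φ) E' p' η' ∧
        ∀ x t : ℝ, (x, t) ∈ NHMB.regularSet n U lam φ → ∀ μ : ℂ, ∀ i j : Fin 2,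
          HasDerivAt (fun s => NHMB.darbouxMatrix n lam φ μ x s i j)
            ((NHMB.ptM σ E' μ x t * NHMB.darbouxMatrix n lam φ μ x t
              - NHMB.darbouxMatrix n lam φ μ x t * NHMB.ptM σ E μ x t) i j) t ∧
          (μ + (ω : ℂ) ≠ 0 →
            HasDerivAt (fun y => NHMB.darbouxMatrix n lam φ μ y t i j)
              ((NHMB.ptN σ ε₁ ε₂ ω E' p' η' μ x t * NHMB.darbouxMatrix n lam φ μ x t
                - NHMB.darbouxMatrix n lam φ μ x t * NHMB.ptN σ ε₁ ε₂ ω E p η μ x t) i j)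
              x)) := by
  have d := NHMB.darbouxData_darbouxCoeff hσ hn hsol hω hφ hlam hζ hpair
  refine ⟨fun x t hU hG => ?_, NHMB.darbouxCoeff n lam φ, fun x t h μ => d.eq_T x t h μ,
    fun x t h => d.det_ne_zero h, ?_⟩
  · obtain ⟨hdet, hT⟩ := NHMB.iteratedDarboux_eq_darbouxMatrix lam φ x t n hG
    exact ⟨⟨hU, hdet⟩, hT⟩
  · rintro E' p' η' rfl rfl rfl
    exact ⟨d.isSolutionOn_new, fun x t h μ i j => ⟨(d.evolution_t h).2 μ i j, fun hμ =>
      (d.evolution_x h rfl rfl rfl rfl rfl rfl rfl).2 μ hμ i j⟩⟩
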